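/- **Corollary (tail coflow-level delay of the CAB policy).** For every $N$ consider an $N\times N$ input-queued switch in slotted time (slot $t$ is the time interval $[t,t+1)$; in each slot every input sends and every output receives at most one packet), initially empty. Coflows $n=0,1,2,\dots$ arrive according to a Poisson process of rate $\lambda>0$ (independent of $N$), all packets of a coflow being released at its arrival. Coflow $n$ has a random traffic matrix $\mathbf X^{(n)}=(X^{(n)}_{ij})\in\mathbb{Z}_{\ge0}^{N\times N}$, where $X^{(n)}_{ij}$ is its number of packets from input $i$ to output $j$; the matrices are i.i.d. copies of a matrix $\mathbf X$ with independent entries (whose law may depend on $N$), and they are independent of the arrival times. Flow sizes are light-tailed, uniformly in $N$: there are $s>0$ and $K<\infty$ such that for all $N,i,j$ $$\mathbb E\big[e^{s\sum_{j'}X_{ij'}}\big]\le K,\qquad \mathbb E\big[e^{s\sum_{i'}X_{i'j}}\big]\le K .$$ Let $\beta_N=\max\big(\max_i\sum_j\mathbb E[X_{ij}],\ \max_j\sum_i\mathbb E[X_{ij}]\big)$ and suppose that there is a constant $\rho<1$ with $\lambda\beta_N\le\rho$ for all $N$. The clearance time $\tau(\mathbf A)$ of a traffic matrix $\mathbf A$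 is its maximal row or column sum. The *coflow-aware batching (CAB) policy* with frame size $T\ge1$ groups the slots into consecutive frames of $T$ slots. The coflows that arrive in a frame are examined in order of arrival, and a coflow is added to the batch of that frame (it is then called *conforming*) whenever the clearance time of the batch together with this coflow is at most $T-1$; otherwise it is *non-conforming*. In the next frame, the batch $\mathbf B$ is cleared in the first $\tau(\mathbf B)\le T-1$ slots by an arbitrary optimal clearance algorithm. Non-conforming coflows join, at the end of the frame in which they arrive, a FIFO queue that is served only in the last slot of each frame, one coflow at a time, each coflow $\mathbf X^{(n)}$ being cleared in $\tau(\mathbf X^{(n)})$ consecutive frames. The *delay* of a coflow is the time from its arrival until all its packets have been transmitted. Then there are frame sizes $T=T_N\ge1$ with $T_N=O(\log N)$, and constants $C,C'$, such that for all sufficiently large $N$, under the CAB policy with frame size $T_N$, an arbitrary coflow has delay at most $C\log N$ with probability at least $1-C'/N^2$; that is, 1. for every $n$, the delay of the $n$-th coflow is at most $C\log N$ with probability at least $1-C'/N^2$; 2. almost surely, the long-run fraction (upper limit as $m\to\infty$ of the fraction among the first $m$ coflows) of coflows whose delay exceeds $C\log N$ is at most $C'/N^2$. -/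

import Mathlib

open MeasureTheory ProbabilityTheory Filter
open scoped NNReal ENNReal

noncomputable section

/-- The traffic matrix of a coflow (or of a batch of coflows): `A i j` is the number of packets to be
sent from input `i` to output `j` of an `N × N` switch. -/
abbrev Traffic (N : ℕ) : Type := Fin N → Fin N → ℕ

/-- Clearance time: the maximal row or column sum of a traffic matrix. -/
def clearanceTime {N : ℕ} (A : Traffic N) : ℕ :=
  max (Finset.univ.sup fun i => ∑ j, A i j) (Finset.univ.sup fun j => ∑ i, A i j)

/-! ### The Coflow-Aware Batching (CAB) policy along one sample path

Coflow `n = 0, 1, 2, …` arrives at time `a n` with traffic matrix `X n`. Slot `t` is the time interval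
`[t, t + 1)`, and frame `k` consists of the `T` slots `k * T, …, k * T + (T - 1)`. -/

/-- The frame in which coflow `n` arrives. -/
def frameOf (T : ℕ) (a : ℕ → ℝ) (n : ℕ) : ℕ := ⌊a n / (T : ℝ)⌋₊

/-- The batch selected among the coflows of frame `k`, after coflows `0, …, n - 1` have been examined
in order of arrival: a coflow of frame `k` is added whenever the clearance time of the batch does
not exceed `T - 1` with it. -/
def selected {N : ℕ} (T : ℕ) (a : ℕ → ℝ) (X : ℕ → Traffic N) (k : ℕ) : ℕ → Traffic N
  | 0 => 0
  | n + 1 =>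
    if frameOf T a n = k ∧ clearanceTime (selected T a X k n + X n) ≤ T - 1 then
      selected T a X k n + X n
    else selected T a X k n

/-- Coflow `n` is conforming if it is added to the batch of the frame in which it arrives. -/
def Conforming {N : ℕ} (T : ℕ) (a : ℕ → ℝ) (X : ℕ → Traffic N) (n : ℕ) : Prop :=
  clearanceTime (selected T a X (frameOf T a n) n + X n) ≤ T - 1

/-- The aggregate traffic matrix of all conforming coflows of frame `k`; it is cleared in frame
`k + 1`. -/
def batch {N : ℕ} (T : ℕ) (a : ℕ → ℝ) (X : ℕ → Traffic N) (k : ℕ) : Traffic N :=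
  fun i j => ∑ᶠ (n : ℕ) (_ : frameOf T a n = k ∧ Conforming T a X n), X n i j

open Classical in
/-- The first frame whose last slot is not needed by the non-conforming coflows among
`0, …, n - 1`. The non-conforming coflows form a FIFO queue, which is served in the last slot of
each frame, one coflow at a time; a coflow joins it at the end of the frame in which it arrives, and
its service takes as many frames as its clearance time. -/
def fifoFree {N : ℕ} (T : ℕ) (a : ℕ → ℝ) (X : ℕ → Traffic N) : ℕ → ℕ
  | 0 => 0
  | n + 1 =>
    if Conforming T a X n then fifoFree T a X n
    else max (fifoFree T a X n) (frameOf T a n + 1) + clearanceTime (X n)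

/-- The first frame in which a non-conforming coflow `n` is served. -/
def fifoStart {N : ℕ} (T : ℕ) (a : ℕ → ℝ) (X : ℕ → Traffic N) (n : ℕ) : ℕ :=
  max (fifoFree T a X n) (frameOf T a n + 1)

/-- A record of all transmissions: `S t i j = some n` means that a packet of coflow `n` is sent from
input `i` to output `j` in slot `t`, and `S t i j = none` that no packet is sent. -/
abbrev Transmissions (N : ℕ) : Type := ℕ → Fin N → Fin N → Option ℕ

/-- `S` is a run of the CAB policy with frame size `T`. The optimal clearance algorithm, i.e. the way
in which a matrix is cleared within its clearance time, and the order among packets of the same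
batch are arbitrary. -/
structure IsCABRun {N : ℕ} (T : ℕ) (a : ℕ → ℝ) (X : ℕ → Traffic N) (S : Transmissions N) :
    Prop where
  /-- each input sends at most one packet per slot -/
  input_constraint : ∀ t i j j', (S t i j).isSome → (S t i j').isSome → j = j'
  /-- each output receives at most one packet per slot -/
  output_constraint : ∀ t i i' j, (S t i j).isSome → (S t i' j).isSome → i = i'
  /-- exactly the packets of each coflow are sent -/
  all_sent : ∀ n i j, {t : ℕ | S t i j = some n}.encard = X n i j
  /-- the batch of conforming coflows of frame `k` is cleared in minimum time from the beginning of
  frame `k + 1` on -/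
  conforming_slots : ∀ n, Conforming T a X n → ∀ t i j, S t i j = some n →
    (frameOf T a n + 1) * T ≤ t ∧
      t < (frameOf T a n + 1) * T + clearanceTime (batch T a X (frameOf T a n))
  /-- a non-conforming coflow is cleared in minimum time in the last slots of consecutive frames, from
  the moment on when it reaches the head of the FIFO queue -/
  nonconforming_slots : ∀ n, ¬ Conforming T a X n → ∀ t i j, S t i j = some n →
    ∃ f, fifoStart T a X n ≤ f ∧ f < fifoStart T a X n + clearanceTime (X n) ∧
      t = f * T + (T - 1)

/-- All packets of coflow `n` have been transmitted by time `x`. -/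
def CompletedBy {N : ℕ} (X : ℕ → Traffic N) (S : Transmissions N) (n : ℕ) (x : ℝ) : Prop :=
  ∀ i j, (X n i j : ℕ∞) ≤ {t : ℕ | (t : ℝ) + 1 ≤ x ∧ S t i j = some n}.encard

/-- Coflow-level delay: the time from the arrival of coflow `n` until all its packets have been
transmitted (`∞` if that never happens). -/
def coflowDelay {N : ℕ} (a : ℕ → ℝ) (X : ℕ → Traffic N) (S : Transmissions N) (n : ℕ) : ℝ≥0∞ :=
  ⨅ (d : ℝ≥0) (_ : CompletedBy X S n (a n + d)), (d : ℝ≥0∞)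

open Classical in
/-- The fraction of the coflows `0, …, m - 1` whose delay exceeds `x`. -/
def lateFraction {N : ℕ} (a : ℕ → ℝ) (X : ℕ → Traffic N) (S : Transmissions N) (x : ℝ≥0∞)
    (m : ℕ) : ℝ :=
  (((Finset.range m).filter fun n => x < coflowDelay a X S n).card : ℝ) / (m : ℝ)

/-! ### The stochastic model -/

/-- The number of arrivals in the time interval `[s, t)`. -/
def arrivalCount (a : ℕ → ℝ) (s t : ℝ≥0) : ℕ := {n : ℕ | (s : ℝ) ≤ a n ∧ a n < t}.ncard

/-- `a 0 ≤ a 1 ≤ …` are the arrival times of a Poisson process of rate `lam` on `[0, ∞)`. -/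
structure IsPoissonArrivals {Ω : Type*} [MeasurableSpace Ω] (μ : Measure Ω) (lam : ℝ≥0)
    (a : ℕ → Ω → ℝ) : Prop where
  measurable : ∀ n, Measurable (a n)
  nonneg : ∀ᵐ ω ∂μ, ∀ n, 0 ≤ a n ω
  mono : ∀ᵐ ω ∂μ, Monotone fun n => a n ω
  locally_finite : ∀ᵐ ω ∂μ, Tendsto (fun n => a n ω) atTop atTop
  poisson_increments : ∀ s t : ℝ≥0, s ≤ t →
    HasLaw (fun ω => arrivalCount (fun n => a n ω) s t) (poissonMeasure (lam * (t - s))) μ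
  independent_increments : ∀ t : ℕ → ℝ≥0, Monotone t →
    iIndepFun (fun k ω => arrivalCount (fun n => a n ω) (t k) (t (k + 1))) μ

/-- Coflows arrive according to a Poisson process of rate `lam`; their traffic matrices are i.i.d. and
independent of the arrival times, and the entries of each matrix are independent. -/
structure IsCoflowModel {N : ℕ} {Ω : Type*} [MeasurableSpace Ω] (μ : Measure Ω) (lam : ℝ≥0)
    (a : ℕ → Ω → ℝ) (X : ℕ → Ω → Traffic N) : Prop where
  arrivals : IsPoissonArrivals μ lam a
  measurable : ∀ n, Measurable (X n)
  arrivals_indep : IndepFun (fun ω n => a n ω) (fun ω n => X n ω) μ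
  coflows_indep : iIndepFun X μ
  coflows_ident : ∀ n, IdentDistrib (X n) (X 0) μ μ
  entries_indep : ∀ n, iIndepFun (fun (p : Fin N × Fin N) ω => X n ω p.1 p.2) μ

/-- `β`: the maximal mean number of packets that a coflow with random traffic matrix `Y` brings to
one port. -/
def meanPortLoad {N : ℕ} {Ω : Type*} [MeasurableSpace Ω] (μ : Measure Ω) (Y : Ω → Traffic N) : ℝ :=
  max (⨆ i, ∑ j, ∫ ω, (Y ω i j : ℝ) ∂μ) (⨆ j, ∑ i, ∫ ω, (Y ω i j : ℝ) ∂μ)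

/-- The moment generating function of the number of packets that the coflow brings to any one port is
finite at `s` and at most `K` there. -/
def PortMGFBound {N : ℕ} {Ω : Type*} [MeasurableSpace Ω] (μ : Measure Ω) (Y : Ω → Traffic N)
    (s K : ℝ) : Prop :=
  (∀ i, Integrable (fun ω => Real.exp (s * ((∑ j, Y ω i j : ℕ) : ℝ))) μ ∧
    mgf (fun ω => ((∑ j, Y ω i j : ℕ) : ℝ)) μ s ≤ K) ∧
  (∀ j, Integrable (fun ω => Real.exp (s * ((∑ i, Y ω i j : ℕ) : ℝ))) μ ∧
    mgf (fun ω => ((∑ i, Y ω i j : ℕ) : ℝ)) μ s ≤ K)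

end

/-! ### Deterministic properties of the CAB policy -/

/-! A conforming coflow is finished at most `2 * T` after its arrival
(`coflowDelay_le_of_conforming`), so with `C * log N ≥ 2 * T` only non-conforming coflows can be
late. It suffices to show that these are rare; the FIFO queue is never analysed.

The coflows of a frame are consecutive. If the `j`-th coflow of a frame (counted from `0`) is
rejected, the first `j + 1` coflows of that frame together load some port with at least `T` packets
(`overload_of_not_conforming`). This event, `Overload`, involves neither the policy nor the arrival
times. Let `M` be the number of arrivals in a frame, a Poisson variable of mean `lam * T`. By
independence the mean number of overloads per frame, `overloadRate`, is `∑ j, P(j < M) * P(Overload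
j)`.

A Chernoff bound over the `2 * N` ports gives `P(Overload j) ≤ 2 * N * exp (-θ * T) * φ ^ (j + 1)`,
where `φ` bounds the moment generating functions of the port loads at `θ`. Summing against the
Poisson tail costs a factor `φ / (φ - 1) * exp (lam * T * (φ - 1))`. Subcritical load permits `η = θ
- lam * (φ - 1) > 0` (`exists_portMGFBound`), so the rate is `O(N * exp (-η * T))`, which is
`O(N⁻²)` once `T ≥ (3 / η) * log N`.

Two arguments pass from frames to coflows. For a fixed coflow `n`, the frame in which it arrives is
random and size-biased; summing over all frames and all positions within them gives `P(n
non-conforming) * P(M > 0) ≤ overloadRate` (`IsCoflowModel.measure_not_conforming_mul_le`). For the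
long-run fraction, the strong law applies to overloads and to arrivals per frame, and the limit is
at most the quotient of the two means (`limsup_lateFraction_le`). -/

theorem clearanceTime_mono {N : ℕ} {A B : Traffic N} (h : A ≤ B) :
    clearanceTime A ≤ clearanceTime B := by
  refine max_le_max ?_ ?_
  · exact Finset.sup_mono_fun fun i _ => Finset.sum_le_sum fun j _ => h i j
  · exact Finset.sup_mono_fun fun j _ => Finset.sum_le_sum fun i _ => h i j

theorem clearanceTime_zero {N : ℕ} : clearanceTime (0 : Traffic N) = 0 := by
  simp [clearanceTime]

theorem le_clearanceTime_iff {N : ℕ} {A : Traffic N} {T : ℕ} (hT : 1 ≤ T) :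
    T ≤ clearanceTime A ↔ (∃ i, T ≤ ∑ j, A i j) ∨ ∃ j, T ≤ ∑ i, A i j := by
  have hT' : ⊥ < T := hT
  simp [clearanceTime, Finset.le_sup_iff hT']

theorem clearanceTime_selected_le {N : ℕ} (T : ℕ) (a : ℕ → ℝ) (X : ℕ → Traffic N) (k n : ℕ) :
    clearanceTime (selected T a X k n) ≤ T - 1 := by
  induction n with
  | zero => simp [selected, clearanceTime_zero]
  | succ n ih =>
    rw [selected]
    split_ifs with h
    · exact h.2
    · exact ih

open Classical in
theorem selected_eq_sum {N : ℕ} (T : ℕ) (a : ℕ → ℝ) (X : ℕ → Traffic N) (k n : ℕ) :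
    selected T a X k n =
      ∑ m ∈ (Finset.range n).filter fun m => frameOf T a m = k ∧ Conforming T a X m, X m := by
  induction n with
  | zero => simp [selected]
  | succ n ih =>
    have hiff : (frameOf T a n = k ∧ clearanceTime (selected T a X k n + X n) ≤ T - 1) ↔
        (frameOf T a n = k ∧ Conforming T a X n) := by
      constructor
      · rintro ⟨rfl, h⟩
        exact ⟨rfl, h⟩
      · rintro ⟨rfl, h⟩
        exact ⟨rfl, h⟩
    rw [selected, Finset.range_add_one, Finset.filter_insert]
    by_cases h : frameOf T a n = k ∧ Conforming T a X n
    · rw [if_pos (hiff.2 h), if_pos h, Finset.sum_insert (by simp), ← ih, add_comm]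
    · rw [if_neg (fun h' => h (hiff.1 h')), if_neg h, ih]

open Classical in
theorem selected_le_sum {N : ℕ} (T : ℕ) (a : ℕ → ℝ) (X : ℕ → Traffic N) (k n : ℕ) :
    selected T a X k n ≤ ∑ m ∈ (Finset.range n).filter fun m => frameOf T a m = k, X m := by
  rw [selected_eq_sum]
  refine Finset.sum_le_sum_of_subset_of_nonneg ?_ fun m _ _ i j => Nat.zero_le _
  intro m hm
  simp only [Finset.mem_filter] at hm ⊢
  exact ⟨hm.1, hm.2.1⟩

/-- The sample paths of a Poisson process: nonnegative, nondecreasing, locally finite. -/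
structure IsArrivalPath (a : ℕ → ℝ) : Prop where
  nonneg : ∀ n, 0 ≤ a n
  mono : Monotone a
  locally_finite : Tendsto a atTop atTop

theorem le_frameOf_iff {T : ℕ} (hT : 1 ≤ T) {a : ℕ → ℝ} (ha : IsArrivalPath a) (k n : ℕ) :
    k ≤ frameOf T a n ↔ (k * T : ℝ) ≤ a n := by
  have hT' : (0 : ℝ) < T := by exact_mod_cast hT
  rw [frameOf, Nat.le_floor_iff (div_nonneg (ha.nonneg n) hT'.le), le_div_iff₀ hT']

theorem frameOf_eq_iff {T : ℕ} (hT : 1 ≤ T) {a : ℕ → ℝ} (ha : IsArrivalPath a) (k n : ℕ) :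
    frameOf T a n = k ↔ (k * T : ℝ) ≤ a n ∧ a n < ((k + 1 : ℕ) * T : ℝ) := by
  rw [← le_frameOf_iff hT ha, ← not_le, ← le_frameOf_iff hT ha]
  omega

theorem exists_forall_lt_frameOf {T : ℕ} (hT : 1 ≤ T) {a : ℕ → ℝ} (ha : IsArrivalPath a)
    (k : ℕ) : ∃ n₀, ∀ n, n₀ ≤ n → k < frameOf T a n := by
  obtain ⟨n₀, h⟩ :=
    (tendsto_atTop.1 ha.locally_finite (((k + 1 : ℕ) : ℝ) * T)).exists_forall_of_atTop
  exact ⟨n₀, fun n hn => (le_frameOf_iff hT ha _ _).2 (h n hn)⟩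

theorem clearanceTime_batch_le {N T : ℕ} (hT : 1 ≤ T) {a : ℕ → ℝ} (ha : IsArrivalPath a)
    (X : ℕ → Traffic N) (k : ℕ) : clearanceTime (batch T a X k) ≤ T - 1 := by
  classical
  -- Local finiteness: from some index on all coflows arrive after frame `k`, so the finsum defining
  -- the batch is a finite sum and the selection has stabilised.
  obtain ⟨n₀, hn₀⟩ := exists_forall_lt_frameOf hT ha k
  have : batch T a X k = selected T a X k n₀ := by
    funext i j
    change ∑ᶠ (n : ℕ) (_ : n ∈ {m | frameOf T a m = k ∧ Conforming T a X m}), X n i j = _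
    rw [selected_eq_sum, finsum_mem_def, finsum_eq_sum_of_support_subset
      (s := (Finset.range n₀).filter fun m => frameOf T a m = k ∧ Conforming T a X m)]
    · rw [Finset.sum_apply, Finset.sum_apply]
      refine Finset.sum_congr rfl fun m hm => ?_
      simp only [Finset.mem_filter] at hm
      exact Set.indicator_of_mem (s := {m | frameOf T a m = k ∧ Conforming T a X m}) hm.2 _
    · intro m hm
      have hm' : m ∈ {m | frameOf T a m = k ∧ Conforming T a X m} := by
        by_contra hcon
        exact hm (Set.indicator_of_notMem hcon _)
      simp only [Finset.coe_filter, Finset.mem_range, Set.mem_ofPred_eq]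
      refine ⟨?_, hm'⟩
      by_contra hlt
      exact (hn₀ m (not_lt.1 hlt)).ne' hm'.1
  rw [this]
  exact clearanceTime_selected_le T a X k n₀

/-- A conforming coflow is cleared by the end of the frame after the one in which it arrives. -/
theorem coflowDelay_le_of_conforming {N T : ℕ} (hT : 1 ≤ T) {a : ℕ → ℝ} (ha : IsArrivalPath a)
    {X : ℕ → Traffic N} {S : Transmissions N} (hS : IsCABRun T a X S) {n : ℕ}
    (hn : Conforming T a X n) : coflowDelay a X S n ≤ ENNReal.ofReal (2 * T) := by
  have hc : CompletedBy X S n (a n + ((2 * T : ℕ) : ℝ≥0)) := by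
    intro i j
    rw [← hS.all_sent n i j]
    refine Set.encard_le_encard fun t ht => ⟨?_, ht⟩
    have h1 := (hS.conforming_slots n hn t i j ht).2
    have h2 := clearanceTime_batch_le hT ha X (frameOf T a n)
    have h3 : t + 1 ≤ (frameOf T a n) * T + 2 * T := by
      have : (frameOf T a n + 1) * T = frameOf T a n * T + T := by ring
      omega
    have h4 := (le_frameOf_iff hT ha (frameOf T a n) n).1 le_rfl
    have h5 : ((t + 1 : ℕ) : ℝ) ≤ ((frameOf T a n) * T + 2 * T : ℕ) := by exact_mod_cast h3
    push_cast at h5 ⊢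
    linarith
  unfold coflowDelay
  refine (iInf₂_le ((2 * T : ℕ) : ℝ≥0) hc).trans (le_of_eq ?_)
  rw [show (2 * T : ℝ) = ((2 * T : ℕ) : ℝ) by push_cast; rfl, ENNReal.ofReal_natCast]
  rfl

/-! ### Arrivals counted frame by frame -/

/-- The number of arrivals before frame `k`. -/
noncomputable def arrivalsBefore (T : ℕ) (a : ℕ → ℝ) (k : ℕ) : ℕ :=
  arrivalCount a 0 (k * T : ℕ)

/-- The number of arrivals in frame `k`. -/
noncomputable def arrivalsIn (T : ℕ) (a : ℕ → ℝ) (k : ℕ) : ℕ :=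
  arrivalCount a (k * T : ℕ) ((k + 1) * T : ℕ)

/-- Arrival times are monotone, so the coflows arriving before frame `k` form an initial segment of
`ℕ`, whose cardinality is its endpoint. Hence each frame owns a block of consecutive indices. -/
theorem lt_arrivalsBefore_iff {T : ℕ} (hT : 1 ≤ T) {a : ℕ → ℝ} (ha : IsArrivalPath a)
    (k n : ℕ) : n < arrivalsBefore T a k ↔ frameOf T a n < k := by
  obtain ⟨n₀, hn₀⟩ := exists_forall_lt_frameOf hT ha k
  have hset : {n : ℕ | ((0 : ℝ≥0) : ℝ) ≤ a n ∧ a n < ((k * T : ℕ) : ℝ≥0)} =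
      {n | frameOf T a n < k} := by
    ext n
    rw [Set.mem_ofPred_eq, Set.mem_ofPred_eq, ← not_le, ← not_le, le_frameOf_iff hT ha]
    simp [ha.nonneg n]
  have hmono : Monotone (frameOf T a) := fun m n h =>
    (le_frameOf_iff hT ha _ _).2 (((le_frameOf_iff hT ha _ _).1 le_rfl).trans (ha.mono h))
  have hex : ∃ n, k ≤ frameOf T a n := ⟨n₀, (hn₀ n₀ le_rfl).le⟩
  classical
  have hset' : {n | frameOf T a n < k} = (Finset.range (Nat.find hex) : Set ℕ) := by
    ext n
    simp only [Set.mem_ofPred_eq, Finset.coe_range, Set.mem_Iio, Nat.lt_find_iff, not_le]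
    exact ⟨fun h m hm => (hmono hm).trans_lt h, fun h => h n le_rfl⟩
  have hcard : arrivalsBefore T a k = Nat.find hex := by
    rw [arrivalsBefore, arrivalCount, hset, hset', Set.ncard_coe_finset, Finset.card_range]
  rw [hcard]
  have := Set.ext_iff.1 hset' n
  simpa using this.symm

theorem frameOf_eq_iff_mem {T : ℕ} (hT : 1 ≤ T) {a : ℕ → ℝ} (ha : IsArrivalPath a) (k n : ℕ) :
    frameOf T a n = k ↔ arrivalsBefore T a k ≤ n ∧ n < arrivalsBefore T a (k + 1) := by
  rw [← not_lt, lt_arrivalsBefore_iff hT ha, lt_arrivalsBefore_iff hT ha]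
  omega

theorem arrivalsBefore_mono {T : ℕ} (hT : 1 ≤ T) {a : ℕ → ℝ} (ha : IsArrivalPath a) :
    Monotone (arrivalsBefore T a) := by
  intro k l hkl
  by_contra! h
  have := (lt_arrivalsBefore_iff hT ha _ _).1 h
  exact lt_irrefl _ ((lt_arrivalsBefore_iff hT ha _ _).2 (this.trans_le hkl))

theorem arrivalsBefore_succ {T : ℕ} (hT : 1 ≤ T) {a : ℕ → ℝ} (ha : IsArrivalPath a) (k : ℕ) :
    arrivalsBefore T a (k + 1) = arrivalsBefore T a k + arrivalsIn T a k := by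
  have hset : {n : ℕ | (((k * T : ℕ) : ℝ≥0) : ℝ) ≤ a n ∧ a n < (((k + 1) * T : ℕ) : ℝ≥0)} =
      (Finset.Ico (arrivalsBefore T a k) (arrivalsBefore T a (k + 1)) : Set ℕ) := by
    ext n
    rw [Finset.coe_Ico, Set.mem_Ico, ← frameOf_eq_iff_mem hT ha, frameOf_eq_iff hT ha]
    simp
  have : arrivalsIn T a k = arrivalsBefore T a (k + 1) - arrivalsBefore T a k := by
    rw [arrivalsIn, arrivalCount, hset, Set.ncard_coe_finset, Nat.card_Ico]
  have := arrivalsBefore_mono hT ha (Nat.le_succ k)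
  simp only [Nat.succ_eq_add_one] at this
  omega

theorem arrivalsBefore_zero (T : ℕ) (a : ℕ → ℝ) : arrivalsBefore T a 0 = 0 := by
  have : {n : ℕ | ((0 : ℝ≥0) : ℝ) ≤ a n ∧ a n < (((0 * T : ℕ) : ℝ≥0) : ℝ)} = ∅ := by
    ext n
    simp
  rw [arrivalsBefore, arrivalCount, this, Set.ncard_empty]

theorem arrivalsBefore_eq_sum {T : ℕ} (hT : 1 ≤ T) {a : ℕ → ℝ} (ha : IsArrivalPath a) (k : ℕ) :
    arrivalsBefore T a k = ∑ i ∈ Finset.range k, arrivalsIn T a i := by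
  induction k with
  | zero => simp [arrivalsBefore_zero]
  | succ k ih => rw [arrivalsBefore_succ hT ha, Finset.sum_range_succ, ih]

/-! ### Overloads as a policy-free bound on non-conformity -/

/-- The coflows `p, …, p + j` cannot be cleared in fewer than `T` slots. -/
def Overload {N : ℕ} (T : ℕ) (x : ℕ → Traffic N) (p j : ℕ) : Prop :=
  T ≤ clearanceTime (∑ l ∈ Finset.range (j + 1), x (p + l))

/-- The selected batch is dominated by the sum of all earlier coflows of the frame. Enlarging it to
that sum removes the dependence on previous decisions, and clearance time is monotone. -/
theorem overload_of_not_conforming {N T : ℕ} (hT : 1 ≤ T) {a : ℕ → ℝ} (ha : IsArrivalPath a)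
    {X : ℕ → Traffic N} {n k j : ℕ} (hn : ¬ Conforming T a X n) (hk : frameOf T a n = k)
    (hj : arrivalsBefore T a k + j = n) : Overload T X (arrivalsBefore T a k) j := by
  classical
  have h1 : T ≤ clearanceTime (selected T a X k n + X n) := by
    rw [Conforming, hk] at hn
    omega
  refine h1.trans (clearanceTime_mono ?_)
  rw [Finset.sum_range_succ, hj]
  refine add_le_add ((selected_le_sum T a X k n).trans ?_) le_rfl
  have hsub : ((Finset.range n).filter fun m => frameOf T a m = k) ⊆
      (Finset.range j).image fun l => arrivalsBefore T a k + l := by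
    intro m hm
    simp only [Finset.mem_filter, Finset.mem_range, Finset.mem_image] at hm ⊢
    have := ((frameOf_eq_iff_mem hT ha k m).1 hm.2).1
    exact ⟨m - arrivalsBefore T a k, by omega, by omega⟩
  refine (Finset.sum_le_sum_of_subset_of_nonneg hsub fun m _ _ i j => Nat.zero_le _).trans ?_
  rw [Finset.sum_image fun x _ y _ h => by simpa using h]

open Classical in
/-- The number of initial segments of the first `m` coflows of `x` that cannot be cleared in fewer
than `T` slots. -/
noncomputable def overloadCount {N : ℕ} (T m : ℕ) (x : ℕ → Traffic N) : ℕ :=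
  ((Finset.range m).filter fun j => Overload T x 0 j).card

theorem overload_shift {N : ℕ} (T : ℕ) (x : ℕ → Traffic N) (p j : ℕ) :
    Overload T (fun l => x (p + l)) 0 j ↔ Overload T x p j := by
  simp [Overload]

theorem overloadCount_congr {N : ℕ} (T m : ℕ) {x y : ℕ → Traffic N} (h : ∀ l < m, x l = y l) :
    overloadCount T m x = overloadCount T m y := by
  classical
  unfold overloadCount
  congr 1
  refine Finset.filter_congr fun j hj => ?_
  rw [Overload, Overload, Finset.sum_congr rfl]
  intro l hl
  simp only [Finset.mem_range] at hl hj
  rw [h _ (by omega)]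

/-- A bound on the number of nonconforming coflows of frame `k`. -/
noncomputable def frameOverload {N : ℕ} (T : ℕ) (a : ℕ → ℝ) (X : ℕ → Traffic N) (k : ℕ) : ℕ :=
  overloadCount T (arrivalsIn T a k) fun l => X (arrivalsBefore T a k + l)

open Classical in
theorem card_not_conforming_le {N T : ℕ} (hT : 1 ≤ T) {a : ℕ → ℝ} (ha : IsArrivalPath a)
    (X : ℕ → Traffic N) (k : ℕ) :
    ((Finset.range (arrivalsBefore T a k)).filter fun n => ¬ Conforming T a X n).card ≤
      ∑ i ∈ Finset.range k, frameOverload T a X i := by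
  induction k with
  | zero => simp [arrivalsBefore_zero]
  | succ k ih =>
    rw [Finset.sum_range_succ, arrivalsBefore_succ hT ha]
    have hsub : ((Finset.range (arrivalsBefore T a k + arrivalsIn T a k)).filter
        fun n => ¬ Conforming T a X n) ⊆
        ((Finset.range (arrivalsBefore T a k)).filter fun n => ¬ Conforming T a X n) ∪
        ((Finset.range (arrivalsIn T a k)).filter fun j =>
          Overload T (fun l => X (arrivalsBefore T a k + l)) 0 j).image
            fun j => arrivalsBefore T a k + j := by
      intro n hn
      simp only [Finset.mem_filter, Finset.mem_range, Finset.mem_union, Finset.mem_image] at hn ⊢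
      rcases lt_or_ge n (arrivalsBefore T a k) with h | h
      · exact Or.inl ⟨h, hn.2⟩
      · refine Or.inr ⟨n - arrivalsBefore T a k, ⟨by omega, ?_⟩, by omega⟩
        rw [overload_shift]
        refine overload_of_not_conforming hT ha hn.2 ?_ (by omega)
        rw [frameOf_eq_iff_mem hT ha, arrivalsBefore_succ hT ha]
        exact ⟨h, hn.1⟩
    refine (Finset.card_le_card hsub).trans ((Finset.card_union_le _ _).trans ?_)
    exact add_le_add ih Finset.card_image_le

/-! ### Measurability -/

theorem measurable_arrivalCount (s t : ℝ≥0) :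
    Measurable fun a : ℕ → ℝ => arrivalCount a s t :=
  measurable_ncard.comp (measurable_set_iff.2 fun n => measurableSet_setOfPred.1
    ((measurableSet_le measurable_const (measurable_pi_apply n)).inter
      (measurableSet_lt (measurable_pi_apply n) measurable_const)))

theorem measurable_arrivalsBefore (T k : ℕ) :
    Measurable fun a : ℕ → ℝ => arrivalsBefore T a k :=
  measurable_arrivalCount _ _

theorem measurable_arrivalsIn (T k : ℕ) : Measurable fun a : ℕ → ℝ => arrivalsIn T a k :=
  measurable_arrivalCount _ _

theorem measurableSet_overload {N : ℕ} (T p j : ℕ) :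
    MeasurableSet {x : ℕ → Traffic N | Overload T x p j} := by
  have h : Measurable fun x : ℕ → Traffic N => ∑ l ∈ Finset.range (j + 1), x (p + l) :=
    Finset.measurable_fun_sum _ fun l _ => measurable_pi_apply (p + l)
  have h' : Measurable (clearanceTime : Traffic N → ℕ) := Measurable.of_discrete
  exact measurableSet_le measurable_const (h'.comp h)

theorem measurable_overloadCount {N : ℕ} (T m : ℕ) :
    Measurable (overloadCount T m : (ℕ → Traffic N) → ℕ) := by
  classical
  have : (overloadCount T m : (ℕ → Traffic N) → ℕ) =
      fun x => ∑ j ∈ Finset.range m, if Overload T x 0 j then 1 else 0 := by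
    funext x
    rw [overloadCount, Finset.card_filter]
  rw [this]
  exact Finset.measurable_fun_sum _ fun j _ =>
    Measurable.ite (measurableSet_overload T 0 j) measurable_const measurable_const

/-- Allows the length of the block and its starting index to be random; both are discrete, so
measurability is checked for each fixed pair. -/
theorem measurable_overloadCount_shift {N : ℕ} (T : ℕ) :
    Measurable fun z : (ℕ × ℕ) × (ℕ → Traffic N) =>
      overloadCount T z.1.1 fun l => z.2 (z.1.2 + l) := by
  refine measurable_from_prod_countable_right fun d => ?_
  exact (measurable_overloadCount T d.1).comp
    (measurable_pi_lambda _ fun l => measurable_pi_apply (d.2 + l))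

/-! ### Independence of the frames -/

/-- Fubini for the joint law, a product by independence. It is used to freeze the arrival times
while the traffic matrices stay random. -/
theorem ProbabilityTheory.IndepFun.measure_prodMk_mem {Ω E F : Type*} [MeasurableSpace Ω]
    [MeasurableSpace E] [MeasurableSpace F] {μ : Measure Ω} [IsProbabilityMeasure μ] {f : Ω → E}
    {g : Ω → F} (h : IndepFun f g μ) (hf : Measurable f) (hg : Measurable g) {s : Set (E × F)}
    (hs : MeasurableSet s) :
    μ {ω | (f ω, g ω) ∈ s} = ∫⁻ ω, μ {ω' | (f ω, g ω') ∈ s} ∂μ := by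
  have : IsProbabilityMeasure (μ.map g) := Measure.isProbabilityMeasure_map hg.aemeasurable
  have h1 : μ {ω | (f ω, g ω) ∈ s} = μ.map (fun ω => (f ω, g ω)) s :=
    (Measure.map_apply (hf.prodMk hg) hs).symm
  rw [h1, h.map_prod_eq_prod_map_map hf.aemeasurable hg.aemeasurable, Measure.prod_apply hs,
    lintegral_map (measurable_measure_prodMk_left hs) hf]
  refine lintegral_congr fun ω => ?_
  rw [Measure.map_apply hg (measurable_prodMk_left hs)]
  rfl

section Model

variable {N : ℕ} {Ω : Type*} [MeasurableSpace Ω] {μ : Measure Ω}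
  {lam : ℝ≥0} {a : ℕ → Ω → ℝ} {X : ℕ → Ω → Traffic N}

theorem IsPoissonArrivals.ae_isArrivalPath (h : IsPoissonArrivals μ lam a) :
    ∀ᵐ ω ∂μ, IsArrivalPath fun n => a n ω := by
  filter_upwards [h.nonneg, h.mono, h.locally_finite] with ω h1 h2 h3
  exact ⟨h1, h2, h3⟩

theorem IsPoissonArrivals.measurable_path (h : IsPoissonArrivals μ lam a) :
    Measurable fun ω n => a n ω :=
  measurable_pi_lambda _ h.measurable

theorem IsPoissonArrivals.hasLaw_arrivalsIn (h : IsPoissonArrivals μ lam a) (T k : ℕ) :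
    HasLaw (fun ω => arrivalsIn T (fun n => a n ω) k) (poissonMeasure (lam * T)) μ := by
  have := h.poisson_increments (k * T : ℕ) ((k + 1) * T : ℕ)
    (by exact_mod_cast Nat.mul_le_mul_right T (Nat.le_succ k))
  have hT : (((k + 1) * T : ℕ) : ℝ≥0) - ((k * T : ℕ) : ℝ≥0) = T := by
    rw [add_mul, one_mul, Nat.cast_add, add_tsub_cancel_left]
  rwa [hT] at this

theorem IsPoissonArrivals.indepFun_arrivalsIn (h : IsPoissonArrivals μ lam a) (T : ℕ) {j k : ℕ}
    (hjk : j ≠ k) : IndepFun (fun ω => arrivalsIn T (fun n => a n ω) j)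
      (fun ω => arrivalsIn T (fun n => a n ω) k) μ := by
  have := h.independent_increments (fun k => ((k * T : ℕ) : ℝ≥0))
    (fun k l hkl => Nat.cast_le.2 (Nat.mul_le_mul_right T hkl))
  exact this.indepFun hjk

theorem IsPoissonArrivals.indepFun_arrivalsBefore (h : IsPoissonArrivals μ lam a) (T k : ℕ) :
    IndepFun (fun ω => arrivalsBefore T (fun n => a n ω) k)
      (fun ω => arrivalsIn T (fun n => a n ω) k) μ := by
  have hk : k * T ≤ (k + 1) * T := Nat.mul_le_mul_right T (Nat.le_succ k)
  -- The partition `0, k * T, (k + 1) * T`, continued as a constant; its first two increments are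
  -- the counts in question.
  let t : ℕ → ℝ≥0
    | 0 => 0
    | 1 => (k * T : ℕ)
    | _ + 2 => ((k + 1) * T : ℕ)
  have ht : Monotone t := by
    refine monotone_nat_of_le_succ fun n => ?_
    match n with
    | 0 => exact zero_le
    | 1 => exact Nat.cast_le.2 hk
    | _ + 2 => exact le_rfl
  exact (h.independent_increments t ht).indepFun (i := 0) (j := 1) (by simp)

theorem IsCoflowModel.measurable_seq (h : IsCoflowModel μ lam a X) :
    Measurable fun ω n => X n ω :=
  measurable_pi_lambda _ h.measurable

theorem IsCoflowModel.identDistrib_shift (h : IsCoflowModel μ lam a X) (p : ℕ) :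
    IdentDistrib (fun ω l => X (p + l) ω) (fun ω l => X l ω) μ μ :=
  IdentDistrib.pi (X := fun l => X (p + l)) (Y := X)
    (fun l => (h.coflows_ident (p + l)).trans (h.coflows_ident l).symm)
    (h.coflows_indep.precomp (add_right_injective p)) h.coflows_indep

theorem IsCoflowModel.indepFun_overloadCount (h : IsCoflowModel μ lam a X) (T : ℕ)
    {p m q m' : ℕ} (hpq : p + m ≤ q) :
    IndepFun (fun ω => overloadCount T m fun l => X (p + l) ω)
      (fun ω => overloadCount T m' fun l => X (q + l) ω) μ := by
  have hdisj : Disjoint (Finset.Ico p (p + m)) (Finset.Ico q (q + m')) := by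
    rw [Finset.disjoint_left]
    intro x hx hx'
    simp only [Finset.mem_Ico] at hx hx'
    omega
  have hI := h.coflows_indep.indepFun_finset _ _ hdisj h.measurable
  -- The count sees only the coflows of its block, so padding with zero matrices exhibits it as a
  -- function of finitely many coordinates.
  let F : ∀ p m : ℕ, ((Finset.Ico p (p + m) : Finset ℕ) → Traffic N) → ℕ := fun p m y =>
    overloadCount T m fun l =>
      if hl : p + l ∈ Finset.Ico p (p + m) then y ⟨p + l, hl⟩ else 0
  have hF : ∀ p m, Measurable (F p m) := by
    intro p m
    refine (measurable_overloadCount T m).comp (measurable_pi_lambda _ fun l => ?_)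
    split_ifs with hl
    · exact measurable_pi_apply _
    · exact measurable_const
  have hFX : ∀ p m, (fun ω => overloadCount T m fun l => X (p + l) ω) =
      F p m ∘ fun ω (i : (Finset.Ico p (p + m) : Finset ℕ)) => X i ω := by
    intro p m
    funext ω
    refine overloadCount_congr T m fun l hl => ?_
    rw [dif_pos (by simp [hl])]
  rw [hFX, hFX]
  exact hI.comp (hF p m) (hF q m')

theorem IsCoflowModel.measure_overloadCount_shift (h : IsCoflowModel μ lam a X) (T p m : ℕ)
    (B : Set ℕ) : μ {ω | (overloadCount T m fun l => X (p + l) ω) ∈ B} =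
      μ {ω | (overloadCount T m fun l => X l ω) ∈ B} :=
  (h.identDistrib_shift p).measure_mem_eq
    (measurable_overloadCount T m (MeasurableSet.of_discrete (s := B)))

theorem IsCoflowModel.measure_overload_shift (h : IsCoflowModel μ lam a X) (T p j : ℕ) :
    μ {ω | Overload T (fun n => X n ω) p j} = μ {ω | Overload T (fun n => X n ω) 0 j} := by
  have := (h.identDistrib_shift p).measure_mem_eq (measurableSet_overload T 0 j)
  simp only [Set.preimage_ofPred_eq] at this
  rw [← this]
  congr 1
  ext ω
  exact (overload_shift T (fun n => X n ω) p j).symm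

theorem IsCoflowModel.measurable_frameOverload (h : IsCoflowModel μ lam a X) (T k : ℕ) :
    Measurable fun ω => frameOverload T (fun n => a n ω) (fun n => X n ω) k := by
  have hM : Measurable fun ω => arrivalsIn T (fun n => a n ω) k :=
    (measurable_arrivalsIn T k).comp h.arrivals.measurable_path
  have hA : Measurable fun ω => arrivalsBefore T (fun n => a n ω) k :=
    (measurable_arrivalsBefore T k).comp h.arrivals.measurable_path
  have hcomp := (measurable_overloadCount_shift T).comp ((hM.prodMk hA).prodMk h.measurable_seq)
  exact hcomp

/-- The number of overloads in a frame depends on the arrivals only through the number of coflows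
that arrive in the frame. -/
theorem IsCoflowModel.measure_frameOverload_mem [IsProbabilityMeasure μ]
    (h : IsCoflowModel μ lam a X) (T k : ℕ) (B : Set ℕ) :
    μ {ω | frameOverload T (fun n => a n ω) (fun n => X n ω) k ∈ B} =
      ∫⁻ ω, μ {ω' | (overloadCount T (arrivalsIn T (fun n => a n ω) k) fun l => X l ω') ∈ B} ∂μ := by
  have hD : Measurable fun x : ℕ → ℝ => (arrivalsIn T x k, arrivalsBefore T x k) :=
    (measurable_arrivalsIn T k).prodMk (measurable_arrivalsBefore T k)
  have hind := h.arrivals_indep.comp hD measurable_id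
  have := hind.measure_prodMk_mem (hD.comp h.arrivals.measurable_path) h.measurable_seq
    (measurable_overloadCount_shift T (MeasurableSet.of_discrete (s := B)))
  refine this.trans (lintegral_congr fun ω => ?_)
  exact h.measure_overloadCount_shift T _ _ B

/-- With the arrivals frozen, the two counts involve disjoint blocks of coflows, so the joint
probability factorises. By shift invariance each factor depends on the arrivals only through the
number of coflows in its own frame, and these numbers are independent. Pairwise independence
suffices for the strong law. -/
theorem IsCoflowModel.indepFun_frameOverload_of_lt [IsProbabilityMeasure μ]
    (h : IsCoflowModel μ lam a X) {T : ℕ}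
    (hT : 1 ≤ T) {j k : ℕ} (hjk : j < k) :
    IndepFun (fun ω => frameOverload T (fun n => a n ω) (fun n => X n ω) j)
      (fun ω => frameOverload T (fun n => a n ω) (fun n => X n ω) k) μ := by
  rw [indepFun_iff_measure_inter_preimage_eq_mul]
  intro B C _ _
  have hD : Measurable fun x : ℕ → ℝ => ((arrivalsIn T x j, arrivalsBefore T x j),
      (arrivalsIn T x k, arrivalsBefore T x k)) :=
    ((measurable_arrivalsIn T j).prodMk (measurable_arrivalsBefore T j)).prodMk
      ((measurable_arrivalsIn T k).prodMk (measurable_arrivalsBefore T k))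
  have hind := h.arrivals_indep.comp hD measurable_id
  have hs : MeasurableSet {z : ((ℕ × ℕ) × (ℕ × ℕ)) × (ℕ → Traffic N) |
      (overloadCount T z.1.1.1 fun l => z.2 (z.1.1.2 + l)) ∈ B ∧
      (overloadCount T z.1.2.1 fun l => z.2 (z.1.2.2 + l)) ∈ C} := by
    refine MeasurableSet.inter ?_ ?_
    · exact ((measurable_overloadCount_shift T).comp
        ((measurable_fst.comp measurable_fst).prodMk measurable_snd))
        (MeasurableSet.of_discrete (s := B))
    · exact ((measurable_overloadCount_shift T).comp
        ((measurable_snd.comp measurable_fst).prodMk measurable_snd))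
        (MeasurableSet.of_discrete (s := C))
  have hfreeze := hind.measure_prodMk_mem (hD.comp h.arrivals.measurable_path) h.measurable_seq hs
  let g : Set ℕ → ℕ → ℝ≥0∞ := fun B m => μ {ω' | (overloadCount T m fun l => X l ω') ∈ B}
  have hprod : ∀ᵐ ω ∂μ,
      μ {ω' | (overloadCount T (arrivalsIn T (fun n => a n ω) j) fun l =>
          X (arrivalsBefore T (fun n => a n ω) j + l) ω') ∈ B ∧
        (overloadCount T (arrivalsIn T (fun n => a n ω) k) fun l =>
          X (arrivalsBefore T (fun n => a n ω) k + l) ω') ∈ C} =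
      g B (arrivalsIn T (fun n => a n ω) j) * g C (arrivalsIn T (fun n => a n ω) k) := by
    filter_upwards [h.arrivals.ae_isArrivalPath] with ω hω
    have hle : arrivalsBefore T (fun n => a n ω) j + arrivalsIn T (fun n => a n ω) j ≤
        arrivalsBefore T (fun n => a n ω) k := by
      rw [← arrivalsBefore_succ hT hω]
      exact arrivalsBefore_mono hT hω hjk
    have := indepFun_iff_measure_inter_preimage_eq_mul.1 (h.indepFun_overloadCount T hle
      (m' := arrivalsIn T (fun n => a n ω) k)) B C .of_discrete .of_discrete
    refine Eq.trans this ?_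
    exact congrArg₂ _ (h.measure_overloadCount_shift T _ _ B)
      (h.measure_overloadCount_shift T _ _ C)
  have hM : ∀ k, Measurable fun ω => arrivalsIn T (fun n => a n ω) k := fun k =>
    (measurable_arrivalsIn T k).comp h.arrivals.measurable_path
  have hg : ∀ B, Measurable (g B) := fun B => Measurable.of_discrete
  have hmul := lintegral_mul_eq_lintegral_mul_lintegral_of_indepFun ((hg B).comp (hM j))
    ((hg C).comp (hM k))
    ((h.arrivals.indepFun_arrivalsIn T hjk.ne).comp (hg B) (hg C))
  calc _ = _ := hfreeze
    _ = _ := lintegral_congr_ae hprod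
    _ = _ := hmul
    _ = _ := congrArg₂ _ (h.measure_frameOverload_mem T j B).symm
      (h.measure_frameOverload_mem T k C).symm

theorem IsCoflowModel.identDistrib_frameOverload [IsProbabilityMeasure μ]
    (h : IsCoflowModel μ lam a X) (T k : ℕ) :
    IdentDistrib (fun ω => frameOverload T (fun n => a n ω) (fun n => X n ω) k)
      (fun ω => frameOverload T (fun n => a n ω) (fun n => X n ω) 0) μ μ where
  aemeasurable_fst := (h.measurable_frameOverload T k).aemeasurable
  aemeasurable_snd := (h.measurable_frameOverload T 0).aemeasurable
  map_eq := by
    ext B hB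
    rw [Measure.map_apply (h.measurable_frameOverload T k) hB,
      Measure.map_apply (h.measurable_frameOverload T 0) hB]
    refine (h.measure_frameOverload_mem T k B).trans
      (Eq.trans ?_ (h.measure_frameOverload_mem T 0 B).symm)
    let g : ℕ → ℝ≥0∞ := fun m => μ {ω' | (overloadCount T m fun l => X l ω') ∈ B}
    have hid := (h.arrivals.hasLaw_arrivalsIn T k).identDistrib (h.arrivals.hasLaw_arrivalsIn T 0)
    exact (hid.comp (u := g) Measurable.of_discrete).lintegral_eq

/-- The strong law of large numbers for the number of overloads per frame. -/
theorem IsCoflowModel.tendsto_frameOverload [IsProbabilityMeasure μ]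
    (h : IsCoflowModel μ lam a X) {T : ℕ} (hT : 1 ≤ T)
    (hint : Integrable (fun ω => (frameOverload T (fun n => a n ω) (fun n => X n ω) 0 : ℝ)) μ) :
    ∀ᵐ ω ∂μ, Tendsto (fun k : ℕ => (∑ i ∈ Finset.range k,
      (frameOverload T (fun n => a n ω) (fun n => X n ω) i : ℝ)) / k) atTop
      (nhds (∫ ω, (frameOverload T (fun n => a n ω) (fun n => X n ω) 0 : ℝ) ∂μ)) := by
  have hcast : Measurable (Nat.cast : ℕ → ℝ) := Measurable.of_discrete
  refine strong_law_ae_real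
    (fun k ω => (frameOverload T (fun n => a n ω) (fun n => X n ω) k : ℝ)) hint ?_ ?_
  · intro j k hjk
    rcases lt_or_gt_of_ne hjk with hlt | hlt
    · exact (h.indepFun_frameOverload_of_lt hT hlt).comp hcast hcast
    · exact ((h.indepFun_frameOverload_of_lt hT hlt).comp hcast hcast).symm
  · exact fun k => (h.identDistrib_frameOverload T k).comp hcast

/-- The strong law of large numbers for the number of arrivals per frame. -/
theorem IsPoissonArrivals.tendsto_arrivalsIn (h : IsPoissonArrivals μ lam a) (T : ℕ)
    (hint : Integrable (fun ω => (arrivalsIn T (fun n => a n ω) 0 : ℝ)) μ) :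
    ∀ᵐ ω ∂μ, Tendsto (fun k : ℕ => (∑ i ∈ Finset.range k,
      (arrivalsIn T (fun n => a n ω) i : ℝ)) / k) atTop
      (nhds (∫ ω, (arrivalsIn T (fun n => a n ω) 0 : ℝ) ∂μ)) := by
  have hcast : Measurable (Nat.cast : ℕ → ℝ) := Measurable.of_discrete
  refine strong_law_ae_real (fun k ω => (arrivalsIn T (fun n => a n ω) k : ℝ)) hint ?_ ?_
  · exact fun j k hjk => (h.indepFun_arrivalsIn T hjk).comp hcast hcast
  · exact fun k =>
      ((h.hasLaw_arrivalsIn T k).identDistrib (h.hasLaw_arrivalsIn T 0)).comp hcast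

end Model

/-! ### Nonconforming coflows and overloads -/

section Overload

variable {N : ℕ} {Ω : Type*} [MeasurableSpace Ω] {μ : Measure Ω}
  {lam : ℝ≥0} {a : ℕ → Ω → ℝ} {X : ℕ → Ω → Traffic N}

/-- The expected number of overloads in a frame. -/
noncomputable def overloadRate (μ : Measure Ω) (T : ℕ) (a : ℕ → Ω → ℝ) (X : ℕ → Ω → Traffic N) :
    ℝ≥0∞ :=
  ∑' j, μ {ω | j < arrivalsIn T (fun n => a n ω) 0} * μ {ω | Overload T (fun n => X n ω) 0 j}

theorem IsCoflowModel.lintegral_frameOverload (h : IsCoflowModel μ lam a X) (T : ℕ) :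
    ∫⁻ ω, (frameOverload T (fun n => a n ω) (fun n => X n ω) 0 : ℝ≥0∞) ∂μ =
      overloadRate μ T a X := by
  classical
  let s : ℕ → Set Ω := fun j => {ω | j < arrivalsIn T (fun n => a n ω) 0} ∩
    {ω | Overload T (fun n => X n ω) 0 j}
  have hE : ∀ j, MeasurableSet {x : ℕ → ℝ | j < arrivalsIn T x 0} := fun j =>
    measurable_arrivalsIn T 0 (MeasurableSet.of_discrete (s := {m | j < m}))
  have hs : ∀ j, MeasurableSet (s j) := fun j =>
    (h.arrivals.measurable_path (hE j)).inter (h.measurable_seq (measurableSet_overload T 0 j))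
  have hsum : ∀ ω, (frameOverload T (fun n => a n ω) (fun n => X n ω) 0 : ℝ≥0∞) =
      ∑' j, (s j).indicator 1 ω := by
    intro ω
    rw [tsum_eq_sum (s := Finset.range (arrivalsIn T (fun n => a n ω) 0)), frameOverload,
      overloadCount, Finset.card_filter, Nat.cast_sum]
    · refine Finset.sum_congr rfl fun j hj => ?_
      rw [Finset.mem_range] at hj
      simp only [arrivalsBefore_zero, zero_add]
      by_cases hO : Overload T (fun n => X n ω) 0 j
      · rw [if_pos hO, Set.indicator_of_mem (show ω ∈ s j from ⟨hj, hO⟩)]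
        simp
      · rw [if_neg hO, Set.indicator_of_notMem (fun hmem : ω ∈ s j => hO hmem.2)]
        simp
    · intro j hj
      rw [Finset.mem_range] at hj
      exact Set.indicator_of_notMem (fun hmem : ω ∈ s j => hj hmem.1) _
  simp_rw [hsum]
  rw [lintegral_tsum fun j => (measurable_one.indicator (hs j)).aemeasurable, overloadRate]
  refine tsum_congr fun j => ?_
  rw [lintegral_indicator_one (hs j)]
  exact indepFun_iff_measure_inter_preimage_eq_mul.1 h.arrivals_indep _ _ (hE j)
    (measurableSet_overload T 0 j)

/-- The expected number of frames that start right before the arrival of coflow `m` and are not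
empty is at most one. -/
theorem IsPoissonArrivals.tsum_measure_arrivalsBefore_le [IsProbabilityMeasure μ]
    (h : IsPoissonArrivals μ lam a) {T : ℕ} (hT : 1 ≤ T) (m : ℕ) :
    (∑' k, μ {ω | arrivalsBefore T (fun n => a n ω) k = m}) *
      μ {ω | 0 < arrivalsIn T (fun n => a n ω) 0} ≤ 1 := by
  let s : ℕ → Set Ω := fun k => {ω | arrivalsBefore T (fun n => a n ω) k = m} ∩
    {ω | 0 < arrivalsIn T (fun n => a n ω) k}
  have hmeasM : ∀ k, MeasurableSet {ω | 0 < arrivalsIn T (fun n => a n ω) k} := fun k =>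
    (measurable_arrivalsIn T k).comp h.measurable_path
      (MeasurableSet.of_discrete (s := {m | 0 < m}))
  have hmeasA : ∀ k, MeasurableSet {ω | arrivalsBefore T (fun n => a n ω) k = m} := fun k =>
    (measurable_arrivalsBefore T k).comp h.measurable_path (MeasurableSet.of_discrete (s := {m}))
  have hs : ∀ k, μ (s k) = μ {ω | arrivalsBefore T (fun n => a n ω) k = m} *
      μ {ω | 0 < arrivalsIn T (fun n => a n ω) 0} := by
    intro k
    have h1 := indepFun_iff_measure_inter_preimage_eq_mul.1 (h.indepFun_arrivalsBefore T k)
      {m} {m | 0 < m} .of_discrete .of_discrete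
    have h2 := ((h.hasLaw_arrivalsIn T k).identDistrib (h.hasLaw_arrivalsIn T 0)).measure_mem_eq
      (MeasurableSet.of_discrete (s := {m | 0 < m}))
    exact h1.trans (congrArg _ h2)
  rw [← ENNReal.tsum_mul_right]
  simp_rw [← hs]
  refine (tsum_meas_le_meas_iUnion_of_disjoint₀ μ
    (fun k => ((hmeasA k).inter (hmeasM k)).nullMeasurableSet) ?_).trans prob_le_one
  intro k l hkl
  refine measure_mono_null ?_ (ae_iff.1 h.ae_isArrivalPath)
  intro ω hω hgood
  -- On `s i` coflow `m` is the first one of frame `i`. Its frame is unique, so the events are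
  -- almost surely disjoint.
  have key : ∀ i, ω ∈ s i → frameOf T (fun n => a n ω) m = i := by
    rintro i ⟨h1, h2⟩
    rw [frameOf_eq_iff_mem hT hgood, arrivalsBefore_succ hT hgood]
    simp only [Set.mem_ofPred_eq] at h1 h2
    omega
  exact hkl ((key k hω.1).symm.trans (key l hω.2))

/-- Union bound over the frame `k` of coflow `n` and its position `j` in it. Each term factorises
into `P(n - j arrivals before k)`, `P(j < M)` and `P(Overload j)`. The sum over `k` of the first
factor, times `P(M > 0)`, is at most one. Terms with `j > n`, where `n - j` truncates to `0`, only
enlarge the bound. -/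
theorem IsCoflowModel.measure_not_conforming_mul_le [IsProbabilityMeasure μ]
    (h : IsCoflowModel μ lam a X) {T : ℕ} (hT : 1 ≤ T) (n : ℕ) :
    μ {ω | ¬ Conforming T (fun n => a n ω) (fun n => X n ω) n} *
      μ {ω | 0 < arrivalsIn T (fun n => a n ω) 0} ≤ overloadRate μ T a X := by
  let E : ℕ → ℕ → Set (ℕ → ℝ) := fun j k =>
    {x | arrivalsBefore T x k = n - j ∧ j < arrivalsIn T x k}
  have hE : ∀ j k, MeasurableSet (E j k) := fun j k =>
    (measurable_arrivalsBefore T k (MeasurableSet.of_discrete (s := {n - j}))).inter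
      (measurable_arrivalsIn T k (MeasurableSet.of_discrete (s := {m | j < m})))
  have hcover : μ {ω | ¬ Conforming T (fun n => a n ω) (fun n => X n ω) n} ≤
      ∑' j, ∑' k, μ ({ω | (fun n => a n ω) ∈ E j k} ∩
        {ω | Overload T (fun n => X n ω) (n - j) j}) := by
    refine le_trans (measure_mono_ae ?_) ((measure_iUnion_le _).trans
      (ENNReal.tsum_le_tsum fun j => measure_iUnion_le _))
    filter_upwards [h.arrivals.ae_isArrivalPath] with ω hω hnc
    have hf := (frameOf_eq_iff_mem hT hω (frameOf T (fun n => a n ω) n) n).1 rfl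
    rw [arrivalsBefore_succ hT hω] at hf
    have hA : n - (n - arrivalsBefore T (fun n => a n ω) (frameOf T (fun n => a n ω) n)) =
        arrivalsBefore T (fun n => a n ω) (frameOf T (fun n => a n ω) n) := by omega
    refine Set.mem_iUnion.2 ⟨n - arrivalsBefore T (fun n => a n ω) (frameOf T (fun n => a n ω) n),
      Set.mem_iUnion.2 ⟨frameOf T (fun n => a n ω) n, ⟨hA.symm, by omega⟩, ?_⟩⟩
    have hO := overload_of_not_conforming hT hω hnc rfl
      (j := n - arrivalsBefore T (fun n => a n ω) (frameOf T (fun n => a n ω) n)) (by omega)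
    rw [Set.mem_ofPred_eq, hA]
    exact hO
  have hprod : ∀ j k, μ ({ω | (fun n => a n ω) ∈ E j k} ∩
        {ω | Overload T (fun n => X n ω) (n - j) j}) =
      μ {ω | arrivalsBefore T (fun n => a n ω) k = n - j} *
        (μ {ω | j < arrivalsIn T (fun n => a n ω) 0} *
          μ {ω | Overload T (fun n => X n ω) 0 j}) := by
    intro j k
    have h0 := indepFun_iff_measure_inter_preimage_eq_mul.1 h.arrivals_indep _ _ (hE j k)
      (measurableSet_overload T (n - j) j)
    have h1 := indepFun_iff_measure_inter_preimage_eq_mul.1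
      (h.arrivals.indepFun_arrivalsBefore T k) {n - j} {m | j < m} .of_discrete .of_discrete
    have h2 := ((h.arrivals.hasLaw_arrivalsIn T k).identDistrib
      (h.arrivals.hasLaw_arrivalsIn T 0)).measure_mem_eq
      (MeasurableSet.of_discrete (s := {m | j < m}))
    rw [← mul_assoc, ← h.measure_overload_shift T (n - j) j]
    exact h0.trans (congrArg (· * _) (h1.trans (congrArg _ h2)))
  simp_rw [hprod, ENNReal.tsum_mul_right] at hcover
  calc _ ≤ (∑' j, (∑' k, μ {ω | arrivalsBefore T (fun n => a n ω) k = n - j}) *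
        (μ {ω | j < arrivalsIn T (fun n => a n ω) 0} *
          μ {ω | Overload T (fun n => X n ω) 0 j})) *
        μ {ω | 0 < arrivalsIn T (fun n => a n ω) 0} := by gcongr
    _ = ∑' j, ((∑' k, μ {ω | arrivalsBefore T (fun n => a n ω) k = n - j}) *
        μ {ω | 0 < arrivalsIn T (fun n => a n ω) 0}) *
        (μ {ω | j < arrivalsIn T (fun n => a n ω) 0} *
          μ {ω | Overload T (fun n => X n ω) 0 j}) := by
        rw [← ENNReal.tsum_mul_right]
        exact tsum_congr fun j => by ring
    _ ≤ ∑' j, 1 * (μ {ω | j < arrivalsIn T (fun n => a n ω) 0} *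
          μ {ω | Overload T (fun n => X n ω) 0 j}) :=
        ENNReal.tsum_le_tsum fun j => by
          gcongr
          exact h.arrivals.tsum_measure_arrivalsBefore_le hT (n - j)
    _ = overloadRate μ T a X := by simp only [one_mul]; rfl

end Overload

/-! ### Poisson estimates -/

theorem lintegral_pow_poissonMeasure (r : ℝ≥0) {φ : ℝ} (hφ : 0 ≤ φ) :
    ∫⁻ m, ENNReal.ofReal (φ ^ m) ∂(poissonMeasure r) = ENNReal.ofReal (Real.exp (r * (φ - 1))) := by
  have hsum : HasSum (fun n : ℕ => φ ^ n * (Real.exp (-r) * r ^ n / n.factorial))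
      (Real.exp (r * (φ - 1))) := by
    have h := (NormedSpace.expSeries_div_hasSum_exp (r * φ : ℝ)).mul_left (Real.exp (-r))
    rw [← Real.exp_eq_exp_ℝ, ← Real.exp_add] at h
    convert! h using 1
    · funext n
      rw [mul_pow]
      ring
    · congr 1
      ring
  rw [lintegral_countable']
  simp_rw [poissonMeasure_singleton, ← ENNReal.ofReal_mul (pow_nonneg hφ _)]
  rw [← ENNReal.ofReal_tsum_of_nonneg (fun n => by positivity) hsum.summable, hsum.tsum_eq]

/-- Exchanging sum and expectation leaves the geometric sum `∑ j < M, φ ^ (j + 1) ≤ φ / (φ - 1) * φ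
^ M`, and then the Poisson generating function at `φ`. -/
theorem tsum_measure_lt_mul_pow_le {Ω : Type*} [MeasurableSpace Ω] {μ : Measure Ω} {M : Ω → ℕ}
    {r : ℝ≥0} (hM : HasLaw M (poissonMeasure r) μ) {φ : ℝ} (hφ : 1 < φ) :
    ∑' j, μ {ω | j < M ω} * ENNReal.ofReal (φ ^ (j + 1)) ≤
      ENNReal.ofReal (φ / (φ - 1) * Real.exp (r * (φ - 1))) := by
  have hφ0 : 0 ≤ φ := by linarith
  have hle : ∀ m : ℕ, ∑' j, {m : ℕ | j < m}.indicator (fun _ => ENNReal.ofReal (φ ^ (j + 1))) m ≤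
      ENNReal.ofReal (φ / (φ - 1)) * ENNReal.ofReal (φ ^ m) := by
    intro m
    rw [tsum_eq_sum (s := Finset.range m)]
    · have : ∀ j ∈ Finset.range m,
          {m : ℕ | j < m}.indicator (fun _ => ENNReal.ofReal (φ ^ (j + 1))) m =
            ENNReal.ofReal (φ ^ (j + 1)) := fun j hj =>
        Set.indicator_of_mem (s := {m : ℕ | j < m}) (Finset.mem_range.1 hj) _
      rw [Finset.sum_congr rfl this, ← ENNReal.ofReal_sum_of_nonneg fun j _ => by positivity,
        ← ENNReal.ofReal_mul (div_nonneg hφ0 (by linarith))]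
      refine ENNReal.ofReal_le_ofReal ?_
      simp_rw [pow_succ]
      rw [← Finset.sum_mul, geom_sum_eq hφ.ne']
      have h1 : 0 < φ - 1 := by linarith
      rw [div_mul_eq_mul_div, div_mul_eq_mul_div, div_le_div_iff_of_pos_right h1]
      linarith
    · intro j hj
      exact Set.indicator_of_notMem (s := {m : ℕ | j < m}) (by simpa using hj) _
  calc ∑' j, μ {ω | j < M ω} * ENNReal.ofReal (φ ^ (j + 1))
      = ∑' j, ∫⁻ m, {m : ℕ | j < m}.indicator (fun _ => ENNReal.ofReal (φ ^ (j + 1))) m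
          ∂(poissonMeasure r) := by
        refine tsum_congr fun j => ?_
        rw [lintegral_indicator_const MeasurableSet.of_discrete, mul_comm,
          hM.measure_eq (p := fun m => j < m) .of_discrete]
    _ = ∫⁻ m, ∑' j, {m : ℕ | j < m}.indicator (fun _ => ENNReal.ofReal (φ ^ (j + 1))) m
          ∂(poissonMeasure r) := (lintegral_tsum fun j => Measurable.of_discrete.aemeasurable).symm
    _ ≤ ∫⁻ m, ENNReal.ofReal (φ / (φ - 1)) * ENNReal.ofReal (φ ^ m) ∂(poissonMeasure r) :=
        lintegral_mono hle
    _ = _ := by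
        rw [lintegral_const_mul _ Measurable.of_discrete, lintegral_pow_poissonMeasure r hφ0,
          ← ENNReal.ofReal_mul (div_nonneg hφ0 (by linarith))]

theorem measure_pos_of_hasLaw_poissonMeasure {Ω : Type*} [MeasurableSpace Ω] {μ : Measure Ω}
    {M : Ω → ℕ} {r : ℝ≥0} (hM : HasLaw M (poissonMeasure r) μ) :
    μ {ω | 0 < M ω} = ENNReal.ofReal (1 - Real.exp (-r)) := by
  rw [hM.measure_eq (p := fun m => 0 < m) .of_discrete]
  have : {m : ℕ | 0 < m} = {0}ᶜ := by
    ext m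
    simp [Nat.pos_iff_ne_zero]
  rw [this, prob_compl_eq_one_sub (measurableSet_singleton 0), poissonMeasure_singleton,
    ENNReal.ofReal_sub _ (by positivity)]
  simp

theorem integrable_of_hasLaw_poissonMeasure {Ω : Type*} [MeasurableSpace Ω] {μ : Measure Ω}
    {M : Ω → ℕ} {r : ℝ≥0} (hM : HasLaw M (poissonMeasure r) μ) :
    Integrable (fun ω => (M ω : ℝ)) μ := by
  have h : Integrable (fun m : ℕ => (m : ℝ)) (poissonMeasure r) := by
    refine ⟨Measurable.of_discrete.aestronglyMeasurable, ?_⟩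
    refine lt_of_le_of_lt (lintegral_mono fun m => ?_)
      ((lintegral_pow_poissonMeasure r (φ := 2) (by norm_num)).trans_lt ENNReal.ofReal_lt_top)
    rw [Real.enorm_eq_ofReal (Nat.cast_nonneg m)]
    exact ENNReal.ofReal_le_ofReal (by exact_mod_cast Nat.lt_two_pow_self.le)
  rw [← hM.map_eq] at h
  exact h.comp_aemeasurable hM.aemeasurable

/-! ### Chernoff bounds for the port loads -/

theorem Real.exp_le_one_add_add_sq_mul_exp {x : ℝ} (hx : 0 ≤ x) :
    Real.exp x ≤ 1 + x + x ^ 2 * Real.exp x := by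
  have h1 : Real.exp x - 1 ≤ x * Real.exp x := by
    have h := Real.add_one_le_exp (-x)
    have h2 : Real.exp (-x) * Real.exp x = 1 := by rw [← Real.exp_add]; simp
    nlinarith [Real.exp_pos x]
  nlinarith

section Mgf

variable {Ω : Type*} [MeasurableSpace Ω] {μ : Measure Ω} {Y : Ω → ℝ} {s θ K b : ℝ}

theorem integrable_exp_mul_of_le_of_nonneg (hY : Measurable Y) (hY0 : ∀ ω, 0 ≤ Y ω)
    (hint : Integrable (fun ω => Real.exp (s * Y ω)) μ) (hθs : θ ≤ s) :
    Integrable (fun ω => Real.exp (θ * Y ω)) μ := by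
  refine hint.mono' (by fun_prop) (ae_of_all _ fun ω => ?_)
  rw [Real.norm_eq_abs, Real.abs_exp]
  exact Real.exp_le_exp.2 (mul_le_mul_of_nonneg_right hθs (hY0 ω))

theorem integrable_of_integrable_exp_mul_of_nonneg (hY : Measurable Y) (hY0 : ∀ ω, 0 ≤ Y ω)
    (hs : 0 < s) (hint : Integrable (fun ω => Real.exp (s * Y ω)) μ) : Integrable Y μ := by
  refine (hint.const_mul s⁻¹).mono' hY.aestronglyMeasurable (ae_of_all _ fun ω => ?_)
  rw [Real.norm_eq_abs, abs_of_nonneg (hY0 ω), inv_mul_eq_div, le_div_iff₀ hs, mul_comm]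
  linarith [Real.add_one_le_exp (s * Y ω)]

/-- A second-order expansion at `0` with explicit remainder. Half of the exponent `s` absorbs `Y ^
2`, the other half absorbs `exp (θ * Y)`; this is why `θ ≤ s / 2`. -/
theorem mgf_le_of_integral_le [IsProbabilityMeasure μ] (hY : Measurable Y)
    (hY0 : ∀ ω, 0 ≤ Y ω) (hs : 0 < s)
    (hint : Integrable (fun ω => Real.exp (s * Y ω)) μ) (hK : mgf Y μ s ≤ K)
    (hb : ∫ ω, Y ω ∂μ ≤ b) (hθ : 0 ≤ θ) (hθs : θ ≤ s / 2) :
    mgf Y μ θ ≤ 1 + θ * b + θ ^ 2 * (8 / s ^ 2 * K) := by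
  have hYint := integrable_of_integrable_exp_mul_of_nonneg hY hY0 hs hint
  have hpt : ∀ ω, Real.exp (θ * Y ω) ≤
      1 + θ * Y ω + θ ^ 2 * (8 / s ^ 2 * Real.exp (s * Y ω)) := by
    intro ω
    have hy := hY0 ω
    refine (Real.exp_le_one_add_add_sq_mul_exp (mul_nonneg hθ hy)).trans ?_
    have h1 : Y ω ^ 2 ≤ 8 / s ^ 2 * Real.exp (s / 2 * Y ω) := by
      -- The quadratic term of `exp (s / 2 * Y)` is `s ^ 2 * Y ^ 2 / 8`, whence the constant `8 / s
      -- ^ 2`.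
      have := Real.quadratic_le_exp_of_nonneg (x := s / 2 * Y ω) (by positivity)
      rw [div_mul_eq_mul_div, le_div_iff₀ (by positivity)]
      nlinarith [mul_nonneg hs.le hy]
    have h2 : Real.exp (θ * Y ω) ≤ Real.exp (s / 2 * Y ω) := Real.exp_le_exp.2 (by gcongr)
    have h3 : Real.exp (s / 2 * Y ω) * Real.exp (s / 2 * Y ω) = Real.exp (s * Y ω) := by
      rw [← Real.exp_add]
      congr 1
      ring
    have h4 : Y ω ^ 2 * Real.exp (θ * Y ω) ≤ 8 / s ^ 2 * Real.exp (s * Y ω) := by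
      rw [← h3, ← mul_assoc]
      gcongr
    rw [mul_pow, mul_assoc]
    gcongr
  have hI : Integrable (fun ω => 1 + θ * Y ω) μ := (integrable_const _).add (hYint.const_mul θ)
  have hJ : Integrable (fun ω => θ ^ 2 * (8 / s ^ 2 * Real.exp (s * Y ω))) μ :=
    (hint.const_mul _).const_mul _
  calc mgf Y μ θ ≤ ∫ ω, (1 + θ * Y ω + θ ^ 2 * (8 / s ^ 2 * Real.exp (s * Y ω))) ∂μ :=
        integral_mono (integrable_exp_mul_of_le_of_nonneg hY hY0 hint (by linarith))
          (hI.add hJ) hpt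
    _ = 1 + θ * ∫ ω, Y ω ∂μ + θ ^ 2 * (8 / s ^ 2 * mgf Y μ s) := by
        rw [integral_add hI hJ, integral_add (integrable_const _) (hYint.const_mul θ),
          integral_const_mul, integral_const_mul, integral_const_mul, mgf]
        simp
    _ ≤ _ := by gcongr

end Mgf

theorem PortMGFBound.mono {N : ℕ} {Ω : Type*} [MeasurableSpace Ω] {μ : Measure Ω}
    {Z : Ω → Traffic N} {s K K' : ℝ} (h : PortMGFBound μ Z s K)
    (hK : K ≤ K') : PortMGFBound μ Z s K' :=
  ⟨fun i => ⟨(h.1 i).1, (h.1 i).2.trans hK⟩, fun j => ⟨(h.2 j).1, (h.2 j).2.trans hK⟩⟩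

section Ports

variable {N : ℕ} {Ω : Type*} [MeasurableSpace Ω] {μ : Measure Ω} [IsProbabilityMeasure μ]
  {lam : ℝ≥0} {a : ℕ → Ω → ℝ} {X : ℕ → Ω → Traffic N}

theorem IsCoflowModel.measure_load_ge_le (h : IsCoflowModel μ lam a X) (f : Traffic N → ℕ)
    {θ φ : ℝ} (hθ : 0 ≤ θ) (hint : Integrable (fun ω => Real.exp (θ * (f (X 0 ω) : ℝ))) μ)
    (hφ : mgf (fun ω => (f (X 0 ω) : ℝ)) μ θ ≤ φ) (T j : ℕ) :
    μ {ω | T ≤ ∑ l ∈ Finset.range (j + 1), f (X l ω)} ≤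
      ENNReal.ofReal (Real.exp (-θ * T)) * ENNReal.ofReal (φ ^ (j + 1)) := by
  let g : Traffic N → ℝ := fun A => f A
  have hg : Measurable g := Measurable.of_discrete
  let Y : ℕ → Ω → ℝ := fun l ω => g (X l ω)
  have hYm : ∀ l, Measurable (Y l) := fun l => hg.comp (h.measurable l)
  have hYi : iIndepFun Y μ := h.coflows_indep.comp (fun _ => g) fun _ => hg
  have hYd : ∀ l, IdentDistrib (Y l) (Y 0) μ μ := fun l => (h.coflows_ident l).comp hg
  have hexp : Measurable fun y : ℝ => Real.exp (θ * y) := by fun_prop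
  have hYint : ∀ l, Integrable (fun ω => Real.exp (θ * Y l ω)) μ := fun l =>
    ((hYd l).comp hexp).integrable_iff.2 hint
  have hYmgf : ∀ l, mgf (Y l) μ θ ≤ φ := fun l =>
    (((hYd l).comp hexp).integral_eq).trans_le hφ
  have hset : {ω | T ≤ ∑ l ∈ Finset.range (j + 1), f (X l ω)} =
      {ω | (T : ℝ) ≤ (∑ l ∈ Finset.range (j + 1), Y l) ω} := by
    ext ω
    simp only [Set.mem_ofPred_eq, Finset.sum_apply, Y, g]
    exact_mod_cast Iff.rfl
  have hch := measure_ge_le_exp_mul_mgf (μ := μ) (X := ∑ l ∈ Finset.range (j + 1), Y l) (T : ℝ) hθ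
    (hYi.integrable_exp_mul_sum hYm fun l _ => hYint l)
  rw [hset, ← ENNReal.ofReal_mul (Real.exp_pos _).le, ← ofReal_measureReal]
  refine ENNReal.ofReal_le_ofReal (hch.trans ?_)
  gcongr
  rw [hYi.mgf_sum hYm]
  refine (Finset.prod_le_prod (fun l _ => mgf_nonneg) fun l _ => hYmgf l).trans ?_
  simp

/-- Chernoff bound for the probability that some port gets a load of `T` from `j + 1` coflows. -/
theorem IsCoflowModel.measure_overload_le (h : IsCoflowModel μ lam a X) {θ φ : ℝ} (hθ : 0 ≤ θ)
    (hφ : PortMGFBound μ (X 0) θ φ) {T : ℕ} (hT : 1 ≤ T) (j : ℕ) :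
    μ {ω | Overload T (fun n => X n ω) 0 j} ≤
      2 * N * ENNReal.ofReal (Real.exp (-θ * T)) * ENNReal.ofReal (φ ^ (j + 1)) := by
  have hsub : {ω | Overload T (fun n => X n ω) 0 j} ⊆
      (⋃ i, {ω | T ≤ ∑ l ∈ Finset.range (j + 1), ∑ i', X l ω i i'}) ∪
      ⋃ i', {ω | T ≤ ∑ l ∈ Finset.range (j + 1), ∑ i, X l ω i i'} := by
    intro ω hω
    rw [Set.mem_ofPred_eq, Overload, le_clearanceTime_iff hT] at hω
    simp only [Finset.sum_apply, zero_add] at hω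
    rcases hω with ⟨i, hi⟩ | ⟨i, hi⟩
    · rw [Finset.sum_comm] at hi
      exact Or.inl (Set.mem_iUnion.2 ⟨i, hi⟩)
    · rw [Finset.sum_comm] at hi
      exact Or.inr (Set.mem_iUnion.2 ⟨i, hi⟩)
  have hrow : ∀ i, μ {ω | T ≤ ∑ l ∈ Finset.range (j + 1), ∑ i', X l ω i i'} ≤ _ := fun i =>
    h.measure_load_ge_le (fun A => ∑ i', A i i') hθ (hφ.1 i).1 (hφ.1 i).2 T j
  have hcol : ∀ i', μ {ω | T ≤ ∑ l ∈ Finset.range (j + 1), ∑ i, X l ω i i'} ≤ _ := fun i' =>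
    h.measure_load_ge_le (fun A => ∑ i, A i i') hθ (hφ.2 i').1 (hφ.2 i').2 T j
  refine (measure_mono hsub).trans ((measure_union_le _ _).trans ?_)
  refine (add_le_add ((measure_iUnion_fintype_le _ _).trans (Finset.sum_le_sum fun i _ => hrow i))
    ((measure_iUnion_fintype_le _ _).trans (Finset.sum_le_sum fun i _ => hcol i))).trans ?_
  simp only [Finset.sum_const, Finset.card_univ, Fintype.card_fin, nsmul_eq_mul]
  exact le_of_eq (by ring)

theorem IsCoflowModel.overloadRate_le (h : IsCoflowModel μ lam a X) {θ φ : ℝ} (hθ : 0 ≤ θ)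
    (hφ1 : 1 < φ) (hφ : PortMGFBound μ (X 0) θ φ) {T : ℕ} (hT : 1 ≤ T) :
    overloadRate μ T a X ≤ ENNReal.ofReal
      (2 * N * (φ / (φ - 1)) * Real.exp (lam * T * (φ - 1) - θ * T)) := by
  have hφ0 : 0 ≤ φ / (φ - 1) := div_nonneg (by linarith) (by linarith)
  calc overloadRate μ T a X
      ≤ ∑' j, 2 * N * ENNReal.ofReal (Real.exp (-θ * T)) *
          (μ {ω | j < arrivalsIn T (fun n => a n ω) 0} * ENNReal.ofReal (φ ^ (j + 1))) :=
        ENNReal.tsum_le_tsum fun j => (mul_le_mul_right (h.measure_overload_le hθ hφ hT j) _).trans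
          (le_of_eq (by ring))
    _ ≤ 2 * N * ENNReal.ofReal (Real.exp (-θ * T)) * ENNReal.ofReal (φ / (φ - 1) *
          Real.exp ((lam * T : ℝ≥0) * (φ - 1))) := by
        rw [ENNReal.tsum_mul_left]
        gcongr
        exact tsum_measure_lt_mul_pow_le (h.arrivals.hasLaw_arrivalsIn T 0) hφ1
    _ = _ := by
        have h2 : (2 * N : ℝ≥0∞) = ENNReal.ofReal (2 * N) := by
          rw [ENNReal.ofReal_mul (by norm_num)]
          simp
        rw [h2, ← ENNReal.ofReal_mul (by positivity), ← ENNReal.ofReal_mul (by positivity)]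
        congr 1
        rw [sub_eq_add_neg (_ * _ : ℝ), Real.exp_add, ← neg_mul]
        push_cast
        ring

/-- A bound on the exponential moments of the port loads near `0` in terms of their means. -/
theorem PortMGFBound.of_meanPortLoad_le {Z : Ω → Traffic N} (hZ : Measurable Z) {s K θ b : ℝ}
    (hs : 0 < s) (hK : PortMGFBound μ Z s K) (hb : meanPortLoad μ Z ≤ b) (hθ : 0 ≤ θ)
    (hθs : θ ≤ s / 2) : PortMGFBound μ Z θ (1 + θ * b + θ ^ 2 * (8 / s ^ 2 * K)) := by
  have hm : ∀ i j, Measurable fun ω => (Z ω i j : ℝ) := fun i j =>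
    (Measurable.of_discrete (f := fun A : Traffic N => (A i j : ℝ))).comp hZ
  have key : ∀ (u : Fin N → Ω → ℕ), (∀ i, Measurable fun ω => (u i ω : ℝ)) →
      Integrable (fun ω => Real.exp (s * ((∑ i, u i ω : ℕ) : ℝ))) μ →
      mgf (fun ω => ((∑ i, u i ω : ℕ) : ℝ)) μ s ≤ K → ∑ i, ∫ ω, (u i ω : ℝ) ∂μ ≤ b →
      Integrable (fun ω => Real.exp (θ * ((∑ i, u i ω : ℕ) : ℝ))) μ ∧
        mgf (fun ω => ((∑ i, u i ω : ℕ) : ℝ)) μ θ ≤ 1 + θ * b + θ ^ 2 * (8 / s ^ 2 * K) := by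
    intro u hu hint hmgf hmean
    have hY : Measurable fun ω => ((∑ i, u i ω : ℕ) : ℝ) := by
      push_cast
      exact Finset.measurable_fun_sum _ fun i _ => hu i
    have hY0 : ∀ ω, 0 ≤ ((∑ i, u i ω : ℕ) : ℝ) := fun ω => Nat.cast_nonneg _
    have hYint := integrable_of_integrable_exp_mul_of_nonneg hY hY0 hs hint
    have huint : ∀ i, Integrable (fun ω => (u i ω : ℝ)) μ := fun i =>
      hYint.mono' (hu i).aestronglyMeasurable (ae_of_all _ fun ω => by
        rw [Real.norm_eq_abs, abs_of_nonneg (Nat.cast_nonneg _)]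
        exact_mod_cast Finset.single_le_sum (f := fun i => u i ω) (fun _ _ => Nat.zero_le _)
          (Finset.mem_univ i))
    refine ⟨integrable_exp_mul_of_le_of_nonneg hY hY0 hint (by linarith),
      mgf_le_of_integral_le hY hY0 hs hint hmgf ?_ hθ hθs⟩
    push_cast
    rwa [integral_finsetSum _ fun i _ => huint i]
  refine ⟨fun i => key (fun j ω => Z ω i j) (fun j => hm i j) (hK.1 i).1 (hK.1 i).2 ?_,
    fun j => key (fun i ω => Z ω i j) (fun i => hm i j) (hK.2 j).1 (hK.2 j).2 ?_⟩
  · refine le_trans ?_ ((le_max_left _ _).trans hb)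
    exact le_ciSup (f := fun i => ∑ j, ∫ ω, (Z ω i j : ℝ) ∂μ) (Set.finite_range _).bddAbove i
  · refine le_trans ?_ ((le_max_right _ _).trans hb)
    exact le_ciSup (f := fun j => ∑ i, ∫ ω, (Z ω i j : ℝ) ∂μ) (Set.finite_range _).bddAbove j

end Ports

/-! ### Late coflows -/

theorem not_conforming_of_lt_coflowDelay {N T : ℕ} (hT : 1 ≤ T) {a : ℕ → ℝ}
    (ha : IsArrivalPath a) {X : ℕ → Traffic N} {S : Transmissions N} (hS : IsCABRun T a X S)
    {x : ℝ≥0∞} (hx : ENNReal.ofReal (2 * T) ≤ x) {n : ℕ} (hn : x < coflowDelay a X S n) :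
    ¬ Conforming T a X n := fun hc =>
  (hx.trans_lt hn).not_ge (coflowDelay_le_of_conforming hT ha hS hc)

theorem lateFraction_le {N T : ℕ} (hT : 1 ≤ T) {a : ℕ → ℝ} (ha : IsArrivalPath a)
    {X : ℕ → Traffic N} {S : Transmissions N} (hS : IsCABRun T a X S) {x : ℝ≥0∞}
    (hx : ENNReal.ofReal (2 * T) ≤ x) {m : ℕ}
    (hm : 0 < arrivalsBefore T a (frameOf T a m)) :
    lateFraction a X S x m ≤
      (∑ i ∈ Finset.range (frameOf T a m + 1), (frameOverload T a X i : ℝ)) /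
        arrivalsBefore T a (frameOf T a m) := by
  classical
  have hf := (frameOf_eq_iff_mem hT ha (frameOf T a m) m).1 rfl
  -- The numerator is rounded up to the end of the frame of `m`, the denominator down to its
  -- beginning; the extra frame disappears in the limit.
  have hcard : ((Finset.range m).filter fun n => x < coflowDelay a X S n).card ≤
      ∑ i ∈ Finset.range (frameOf T a m + 1), frameOverload T a X i := by
    refine (Finset.card_le_card fun n hn => ?_).trans
      (card_not_conforming_le hT ha X (frameOf T a m + 1))
    simp only [Finset.mem_filter, Finset.mem_range] at hn ⊢
    exact ⟨hn.1.trans hf.2, not_conforming_of_lt_coflowDelay hT ha hS hx hn.2⟩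
  unfold lateFraction
  gcongr
  · exact_mod_cast hcard
  · exact hf.1

/-- If the number of overloads per frame averages to `v` and the number of arrivals per frame to
`r`, then the long-run fraction of late coflows is at most `v / r`. -/
theorem limsup_lateFraction_le {N T : ℕ} (hT : 1 ≤ T) {a : ℕ → ℝ} (ha : IsArrivalPath a)
    {X : ℕ → Traffic N} {S : Transmissions N} (hS : IsCABRun T a X S) {x : ℝ≥0∞}
    (hx : ENNReal.ofReal (2 * T) ≤ x) {v r : ℝ} (hr : 0 < r)
    (hV : Tendsto (fun k : ℕ => (∑ i ∈ Finset.range k, (frameOverload T a X i : ℝ)) / k) atTop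
      (nhds v))
    (hM : Tendsto (fun k : ℕ => (∑ i ∈ Finset.range k, (arrivalsIn T a i : ℝ)) / k) atTop
      (nhds r)) :
    limsup (lateFraction a X S x) atTop ≤ v / r := by
  have hA : Tendsto (fun k : ℕ => (arrivalsBefore T a k : ℝ) / k) atTop (nhds r) := by
    refine hM.congr fun k => ?_
    rw [arrivalsBefore_eq_sum hT ha k]
    push_cast
    rfl
  have hratio : Tendsto (fun k : ℕ => ((k + 1 : ℕ) : ℝ) / k) atTop (nhds 1) := by
    have h := tendsto_one_div_atTop_nhds_zero_nat (𝕜 := ℝ)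
    have h' := h.const_add 1
    rw [add_zero] at h'
    refine h'.congr' ?_
    filter_upwards [eventually_gt_atTop 0] with k hk
    have : (k : ℝ) ≠ 0 := by exact_mod_cast hk.ne'
    push_cast
    field_simp
  have hu : Tendsto (fun k : ℕ => (∑ i ∈ Finset.range (k + 1), (frameOverload T a X i : ℝ)) /
      arrivalsBefore T a k) atTop (nhds (v / r)) := by
    have h := ((hV.comp (tendsto_add_atTop_nat 1)).mul hratio).div hA hr.ne'
    rw [mul_one] at h
    refine h.congr' ?_
    filter_upwards [eventually_gt_atTop 0] with k hk
    have h1 : (k : ℝ) ≠ 0 := by exact_mod_cast hk.ne'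
    have h2 : ((k + 1 : ℕ) : ℝ) ≠ 0 := by positivity
    simp only [Function.comp_apply, Pi.div_apply]
    rw [div_mul_div_cancel₀ h2, div_div_div_cancel_right₀ h1]
  have hframe : Tendsto (frameOf T a) atTop atTop := by
    refine tendsto_atTop.2 fun k => ?_
    obtain ⟨n₀, hn₀⟩ := exists_forall_lt_frameOf hT ha k
    exact eventually_atTop.2 ⟨n₀, fun n hn => (hn₀ n hn).le⟩
  have hpos : ∀ᶠ k in atTop, 0 < arrivalsBefore T a k := by
    filter_upwards [hA.eventually (lt_mem_nhds hr)] with k hk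
    by_contra h0
    have h0' : arrivalsBefore T a k = 0 := by omega
    rw [h0'] at hk
    simp at hk
  have hu' := hu.comp hframe
  rw [← hu'.limsup_eq]
  refine limsup_le_limsup ?_ ?_ hu'.isBoundedUnder_le
  · filter_upwards [hframe.eventually hpos] with m hm
    exact lateFraction_le hT ha hS hx hm
  -- A real `limsup` is meaningful only with such a bound; here the fractions are nonnegative.
  · refine isCoboundedUnder_le_of_le atTop (x := 0) fun m => ?_
    unfold lateFraction
    positivity

theorem IsPoissonArrivals.le_measure_arrivalsIn_pos {Ω : Type*} [MeasurableSpace Ω]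
    {μ : Measure Ω} {lam : ℝ≥0} {a : ℕ → Ω → ℝ} (h : IsPoissonArrivals μ lam a) {T : ℕ} (hT : 1 ≤ T) :
    ENNReal.ofReal (1 - Real.exp (-lam)) ≤
      μ {ω | 0 < arrivalsIn T (fun n => a n ω) 0} := by
  rw [measure_pos_of_hasLaw_poissonMeasure (h.hasLaw_arrivalsIn T 0)]
  have hT' : (1 : ℝ) ≤ T := by exact_mod_cast hT
  have hle : (lam : ℝ) ≤ ((lam * T : ℝ≥0) : ℝ) := by
    push_cast
    nlinarith [lam.coe_nonneg]
  gcongr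

section Late

variable {N : ℕ} {Ω : Type*} [MeasurableSpace Ω] {μ : Measure Ω} [IsProbabilityMeasure μ]
  {lam : ℝ≥0} {a : ℕ → Ω → ℝ} {X : ℕ → Ω → Traffic N}

theorem IsCoflowModel.measure_late_le (h : IsCoflowModel μ lam a X) (hlam : 0 < lam) {T : ℕ}
    (hT : 1 ≤ T) {c : ℝ} (hc : overloadRate μ T a X ≤ ENNReal.ofReal c) {S : Ω → Transmissions N}
    (hS : ∀ ω, IsCABRun T (fun n => a n ω) (fun n => X n ω) (S ω)) {x : ℝ≥0∞}
    (hx : ENNReal.ofReal (2 * T) ≤ x) (n : ℕ) :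
    μ {ω | x < coflowDelay (fun m => a m ω) (fun m => X m ω) (S ω) n} ≤
      ENNReal.ofReal (c / (1 - Real.exp (-lam))) := by
  have hγ : 0 < 1 - Real.exp (-lam) := by
    have : Real.exp (-(lam : ℝ)) < 1 := Real.exp_lt_one_iff.2 (by simpa using hlam)
    linarith
  have hmono : μ {ω | x < coflowDelay (fun m => a m ω) (fun m => X m ω) (S ω) n} ≤
      μ {ω | ¬ Conforming T (fun n => a n ω) (fun n => X n ω) n} := by
    refine measure_mono_ae ?_
    filter_upwards [h.arrivals.ae_isArrivalPath] with ω hω hlate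
    exact not_conforming_of_lt_coflowDelay hT hω (hS ω) hx hlate
  refine hmono.trans ?_
  rw [ENNReal.ofReal_div_of_pos hγ, ENNReal.le_div_iff_mul_le (Or.inl (ENNReal.ofReal_pos.2 hγ).ne')
    (Or.inl ENNReal.ofReal_ne_top)]
  refine le_trans ?_ ((h.measure_not_conforming_mul_le hT n).trans hc)
  gcongr
  exact h.arrivals.le_measure_arrivalsIn_pos hT

theorem IsCoflowModel.ae_limsup_lateFraction_le (h : IsCoflowModel μ lam a X) (hlam : 0 < lam)
    {T : ℕ} (hT : 1 ≤ T) {c : ℝ} (hc0 : 0 ≤ c) (hc : overloadRate μ T a X ≤ ENNReal.ofReal c)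
    {S : Ω → Transmissions N}
    (hS : ∀ ω, IsCABRun T (fun n => a n ω) (fun n => X n ω) (S ω)) {x : ℝ≥0∞}
    (hx : ENNReal.ofReal (2 * T) ≤ x) :
    ∀ᵐ ω ∂μ, limsup (lateFraction (fun n => a n ω) (fun n => X n ω) (S ω) x) atTop ≤
      c / (1 - Real.exp (-lam)) := by
  have hγ : 0 < 1 - Real.exp (-lam) := by
    have : Real.exp (-(lam : ℝ)) < 1 := Real.exp_lt_one_iff.2 (by simpa using hlam)
    linarith
  have hVm : Measurable fun ω => (frameOverload T (fun n => a n ω) (fun n => X n ω) 0 : ℝ) :=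
    (Measurable.of_discrete (f := (Nat.cast : ℕ → ℝ))).comp (h.measurable_frameOverload T 0)
  have hVl : ∫⁻ ω, ENNReal.ofReal (frameOverload T (fun n => a n ω) (fun n => X n ω) 0 : ℝ) ∂μ ≤
      ENNReal.ofReal c := by
    simp_rw [ENNReal.ofReal_natCast]
    rwa [h.lintegral_frameOverload T]
  have hVint : Integrable
      (fun ω => (frameOverload T (fun n => a n ω) (fun n => X n ω) 0 : ℝ)) μ := by
    refine ⟨hVm.aestronglyMeasurable, ?_⟩
    rw [hasFiniteIntegral_iff_ofReal (ae_of_all _ fun ω => Nat.cast_nonneg _)]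
    exact hVl.trans_lt ENNReal.ofReal_lt_top
  have hVle : ∫ ω, (frameOverload T (fun n => a n ω) (fun n => X n ω) 0 : ℝ) ∂μ ≤ c := by
    rw [integral_eq_lintegral_of_nonneg_ae (ae_of_all _ fun ω => Nat.cast_nonneg _)
      hVm.aestronglyMeasurable]
    exact ENNReal.toReal_le_of_le_ofReal hc0 hVl
  have hMint := integrable_of_hasLaw_poissonMeasure (h.arrivals.hasLaw_arrivalsIn T 0)
  -- Markov's inequality at level `1`. The crude bound by `P(M > 0)` yields the same constant as for
  -- a single coflow.
  have hMge : 1 - Real.exp (-lam) ≤ ∫ ω, (arrivalsIn T (fun n => a n ω) 0 : ℝ) ∂μ := by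
    have h1 := mul_meas_ge_le_integral_of_nonneg (μ := μ)
      (ae_of_all _ fun ω => Nat.cast_nonneg (arrivalsIn T (fun n => a n ω) 0)) hMint 1
    rw [one_mul] at h1
    refine le_trans ?_ h1
    have hset : {ω | (1 : ℝ) ≤ (arrivalsIn T (fun n => a n ω) 0 : ℝ)} =
        {ω | 0 < arrivalsIn T (fun n => a n ω) 0} := by
      ext ω
      simp [Nat.succ_le_iff]
    rw [hset]
    exact (ENNReal.ofReal_le_iff_le_toReal (measure_ne_top _ _)).1
      (h.arrivals.le_measure_arrivalsIn_pos hT)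
  filter_upwards [h.arrivals.ae_isArrivalPath, h.tendsto_frameOverload hT hVint,
    h.arrivals.tendsto_arrivalsIn T hMint] with ω hω hV hM
  exact (limsup_lateFraction_le hT hω (hS ω) hx (hγ.trans_le hMge) hV hM).trans
    (div_le_div₀ hc0 hVle hγ hMge)

end Late

/-- In subcritical load the exponential moment of the load that a coflow brings to a port is, at a
small positive argument, smaller than what the service can compensate. -/
theorem exists_portMGFBound {Ω : ℕ → Type*} [∀ N, MeasurableSpace (Ω N)]
    (μ : ∀ N, Measure (Ω N)) [∀ N, IsProbabilityMeasure (μ N)] {lam : ℝ} (hlam : 0 < lam)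
    (Z : ∀ N, Ω N → Traffic N) (hZ : ∀ N, Measurable (Z N))
    (hlight : ∃ s > 0, ∃ K, ∀ N, PortMGFBound (μ N) (Z N) s K)
    {ρ : ℝ} (hρ : ρ < 1) (hload : ∀ N, lam * meanPortLoad (μ N) (Z N) ≤ ρ) :
    ∃ θ > 0, ∃ φ > 1, lam * (φ - 1) < θ ∧ ∀ N, PortMGFBound (μ N) (Z N) θ φ := by
  obtain ⟨s, hs, K, hK⟩ := hlight
  have hρ0 : 0 ≤ ρ := by
    -- The `0 × 0` switch has no ports, and real suprema over an empty family are `0`, so its load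
    -- is `0`.
    have := hload 0
    simpa [meanPortLoad] using this
  let L : ℝ := 8 / s ^ 2 * |K|
  have hL : 0 ≤ L := by positivity
  -- Small enough that the quadratic remainder `lam * θ ^ 2 * L` uses at most half of the slack `θ *
  -- (1 - ρ)`; then `lam * (φ - 1)` may be set to `θ * (1 + ρ) / 2 < θ`.
  let θ : ℝ := min (s / 2) ((1 - ρ) / (2 * lam * (L + 1)))
  have hθ : 0 < θ := lt_min (by positivity) (div_pos (by linarith) (by positivity))
  have hθL : lam * (θ * L) ≤ (1 - ρ) / 2 := by
    have h1 : θ ≤ (1 - ρ) / (2 * lam * (L + 1)) := min_le_right _ _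
    rw [le_div_iff₀ (by positivity)] at h1
    nlinarith [mul_pos hlam hθ]
  refine ⟨θ, hθ, 1 + θ * ((1 + ρ) / 2) / lam, ?_, ?_, fun N => ?_⟩
  · have : 0 < θ * ((1 + ρ) / 2) / lam := by positivity
    linarith
  · rw [add_sub_cancel_left, mul_div_cancel₀ _ hlam.ne']
    nlinarith
  · have hb : meanPortLoad (μ N) (Z N) ≤ ρ / lam := by
      rw [le_div_iff₀ hlam, mul_comm]
      exact hload N
    refine (PortMGFBound.of_meanPortLoad_le (hZ N) hs (hK N) hb hθ.le (min_le_left _ _)).mono ?_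
    have h1 : θ ^ 2 * (8 / s ^ 2 * K) ≤ θ ^ 2 * L := by
      exact mul_le_mul_of_nonneg_left
        (mul_le_mul_of_nonneg_left (le_abs_self K) (by positivity)) (by positivity)
    have h2 : θ * (ρ / lam) + θ ^ 2 * L ≤ θ * ((1 + ρ) / 2) / lam := by
      rw [le_div_iff₀ hlam]
      have h3 : (θ * (ρ / lam) + θ ^ 2 * L) * lam = θ * (ρ + lam * (θ * L)) := by
        field_simp
      rw [h3]
      gcongr
      linarith
    linarith

/-! ### Choice of the frame size and the constants -/

theorem mainTheorem2 {Ω : ℕ → Type*} [∀ N, MeasurableSpace (Ω N)]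
    (μ : ∀ N, Measure (Ω N)) [∀ N, IsProbabilityMeasure (μ N)]
    (lam : ℝ≥0) (hlam : 0 < lam)
    (a : ∀ N, ℕ → Ω N → ℝ) (X : ∀ N, ℕ → Ω N → Traffic N)
    (hmodel : ∀ N, IsCoflowModel (μ N) lam (a N) (X N))
    (hlight : ∃ s > 0, ∃ K, ∀ N, PortMGFBound (μ N) (X N 0) s K)
    (ρ : ℝ) (hρ : ρ < 1) (hload : ∀ N, (lam : ℝ) * meanPortLoad (μ N) (X N 0) ≤ ρ) :
    ∃ T : ℕ → ℕ, (∀ N, 1 ≤ T N) ∧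
      (fun N => (T N : ℝ)) =O[atTop] (fun N : ℕ => Real.log N) ∧
      ∃ C C' : ℝ, ∀ᶠ N : ℕ in atTop,
        ∀ S : Ω N → Transmissions N,
          (∀ ω, IsCABRun (T N) (fun n => a N n ω) (fun n => X N n ω) (S ω)) →
          (∀ n, μ N {ω | ENNReal.ofReal (C * Real.log N) <
              coflowDelay (fun m => a N m ω) (fun m => X N m ω) (S ω) n} ≤
            ENNReal.ofReal (C' / (N : ℝ) ^ 2)) ∧
          (∀ᵐ ω ∂(μ N), limsup (lateFraction (fun n => a N n ω) (fun n => X N n ω) (S ω)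
              (ENNReal.ofReal (C * Real.log N))) atTop ≤ C' / (N : ℝ) ^ 2) := by
  obtain ⟨θ, hθ, φ, hφ1, hφθ, hφ⟩ := exists_portMGFBound μ (NNReal.coe_pos.2 hlam)
    (fun N => X N 0) (fun N => (hmodel N).measurable 0) hlight hρ hload
  let η : ℝ := θ - lam * (φ - 1)
  have hη : 0 < η := sub_pos.2 hφθ
  -- The `3` makes `exp (-η * T) ≤ N⁻³`; one power of `N` is lost to the union over ports. The `+ 1`
  -- ensures `T ≥ 1`, and together with the ceiling it is absorbed by `2 * log N` once `log N ≥ 1`.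
  let T : ℕ → ℕ := fun N => ⌈3 / η * Real.log N⌉₊ + 1
  have hT : ∀ N, 1 ≤ T N := fun N => Nat.le_add_left 1 _
  have hTlog : ∀ᶠ N : ℕ in atTop, (T N : ℝ) ≤ (3 / η + 2) * Real.log N := by
    have hlog : ∀ᶠ N : ℕ in atTop, 1 ≤ Real.log N :=
      (Real.tendsto_log_atTop.comp tendsto_natCast_atTop_atTop).eventually_ge_atTop 1
    filter_upwards [hlog] with N hN
    have h1 := Nat.ceil_lt_add_one (a := 3 / η * Real.log N) (by positivity)
    simp only [T]
    push_cast
    linarith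
  refine ⟨T, hT, ?_, 2 * (3 / η + 2), 2 * (φ / (φ - 1)) / (1 - Real.exp (-lam)), ?_⟩
  · refine Asymptotics.IsBigO.of_bound (3 / η + 2) ?_
    filter_upwards [hTlog] with N hN
    rw [Real.norm_eq_abs, abs_of_nonneg (Nat.cast_nonneg _)]
    exact hN.trans (by gcongr; exact le_abs_self _)
  filter_upwards [hTlog, eventually_gt_atTop 0] with N hN hN0 S hS
  have hN0' : (0 : ℝ) < N := by exact_mod_cast hN0
  have hφ0 : 0 ≤ φ / (φ - 1) := div_nonneg (by linarith) (by linarith)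
  have hexp : Real.exp (lam * T N * (φ - 1) - θ * T N) ≤ 1 / (N : ℝ) ^ 3 := by
    have h1 : 3 / η * Real.log N ≤ T N := by
      have := Nat.le_ceil (3 / η * Real.log N)
      simp only [T]
      push_cast
      linarith
    rw [div_mul_eq_mul_div, div_le_iff₀ hη] at h1
    have h2 : (lam : ℝ) * T N * (φ - 1) - θ * T N = -(T N * η) := by
      simp only [η]
      ring
    rw [h2, Real.exp_neg, one_div]
    refine inv_anti₀ (by positivity) ?_
    calc (N : ℝ) ^ 3 = Real.exp (3 * Real.log N) := by
          rw [← Real.exp_log hN0', ← Real.exp_nat_mul, Real.log_exp]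
          norm_num
      _ ≤ _ := Real.exp_le_exp.2 h1
  have hc : overloadRate (μ N) (T N) (a N) (X N) ≤
      ENNReal.ofReal (2 * (φ / (φ - 1)) / (N : ℝ) ^ 2) := by
    refine ((hmodel N).overloadRate_le hθ.le hφ1 (hφ N) (hT N)).trans
      (ENNReal.ofReal_le_ofReal ?_)
    calc 2 * N * (φ / (φ - 1)) * Real.exp (lam * T N * (φ - 1) - θ * T N)
        ≤ 2 * N * (φ / (φ - 1)) * (1 / (N : ℝ) ^ 3) := by gcongr
      _ = _ := by field_simp
  have hx : ENNReal.ofReal (2 * T N) ≤ ENNReal.ofReal (2 * (3 / η + 2) * Real.log N) := by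
    refine ENNReal.ofReal_le_ofReal ?_
    rw [mul_assoc]
    gcongr
  rw [div_right_comm]
  exact ⟨(hmodel N).measure_late_le hlam (hT N) hc hS hx,
    (hmodel N).ae_limsup_lateFraction_le hlam (hT N) (by positivity) hc hS hx⟩
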